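/- Let $M\in\mathbb N$, let $\mathcal A\subset\{0,\dots,M-1\}$ satisfy $1<|\mathcal A|<M$, and let $\chi\in C_0^\infty((0,1);[0,1])$. Put $\delta=\log|\mathcal A|/\log M\in(0,1)$. For $N\in\mathbb N$ let $\ell^2_N$ be the space of functions $u:\{0,\dots,N-1\}\to\mathbb C$ with norm $\|u\|^2=\sum_j|u(j)|^2$, let $\mathcal F_N u(j)=N^{-1/2}\sum_{\ell=0}^{N-1}e^{-2\pi i j\ell/N}u(\ell)$ be the unitary Fourier transform on $\ell^2_N$, and let $\chi_N$ be the operator of multiplication by $j\mapsto\chi(j/N)$ on $\ell^2_N$. For $k\in\mathbb N$, $k\ge 1$, $N=M^k$ and $a\in\{0,\dots,M-1\}$, let $\Pi_a:\ell^2_N\to\ell^2_{N/M}$ be given by $\Pi_a u(j)=u(j+aN/M)$, and let $$B_N=\sum_{a\in\mathcal A}\mathcal F_N^*\,\Pi_a^*\,\chi_{N/M}\,\mathcal F_{N/M}\,\chi_{N/M}\,\Pi_a:\ \ell^2_N\to\ell^2_N$$ be the quantum open baker's map. For $\nu\ge 0$ let $\mathcal N_k(\nu)$ be the number of eigenvalues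 $\lambda$ of $B_N$, counted with (algebraic) multiplicity, such that $|\lambda|\ge M^{-\nu}$. Then for each $\nu>0$ and each $\varepsilon>0$, we have as $k\to\infty$, with $N=M^k$, $$\mathcal N_k(\nu)=\mathcal O\big(N^{m(\delta,\nu)+\varepsilon}\big),\qquad m(\delta,\nu)=\min(2\nu+2\delta-1,\ \delta),$$ where the implied constant may depend on $M,\mathcal A,\chi,\nu,\varepsilon$. -/

import Mathlib

open Filter Asymptotics
open scoped Matrix ContDiff

noncomputable section

namespace OpenBaker

/-- A cutoff function `χ ∈ C₀^∞((0,1); [0,1])`, extended by zero to the real line. -/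
structure IsCutoff (χ : ℝ → ℝ) : Prop where
  smooth : ContDiff ℝ ∞ χ
  hasCompactSupport : HasCompactSupport χ
  tsupport_subset : tsupport χ ⊆ Set.Ioo 0 1
  mem_Icc : ∀ x, χ x ∈ Set.Icc (0 : ℝ) 1

/-- The unitary discrete Fourier transform on `ℓ²(ℤ/N)`, with `ℤ/N` identified with
`{0, …, N-1}`: `(F_N u)(j) = N^{-1/2} ∑_l exp(-2πi j l / N) u(l)`. -/
def dft (N : ℕ) : Matrix (Fin N) (Fin N) ℂ :=
  Matrix.of fun j l =>
    ((1 / Real.sqrt N : ℝ) : ℂ) *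
      Complex.exp (-(2 * Real.pi * Complex.I * (j : ℕ) * (l : ℕ) / N))

/-- Multiplication by the discretization `χ_N(j) = χ(j / N)`. -/
def cutoff (χ : ℝ → ℝ) (N : ℕ) : Matrix (Fin N) (Fin N) ℂ :=
  Matrix.diagonal fun j => ((χ (((j : ℕ) : ℝ) / N) : ℝ) : ℂ)

/-- The projection `(Π_a u)(j) = u(j + a N / M)` from `ℓ²_N` to `ℓ²_{N/M}`. -/
def proj (M N a : ℕ) : Matrix (Fin (N / M)) (Fin N) ℂ :=
  Matrix.of fun j l => if (l : ℕ) = (j : ℕ) + a * (N / M) then 1 else 0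

/-- The quantum open baker's map
`B_N = ∑_{a ∈ A} F_N^* Π_a^* χ_{N/M} F_{N/M} χ_{N/M} Π_a` (for `M` dividing `N`). -/
def bakerMap (M : ℕ) (A : Finset (Fin M)) (χ : ℝ → ℝ) (N : ℕ) : Matrix (Fin N) (Fin N) ℂ :=
  ∑ a ∈ A, (dft N)ᴴ * (proj M N a)ᴴ *
    (cutoff χ (N / M) * dft (N / M) * cutoff χ (N / M)) * proj M N a

/-- The dimension `δ = log |A| / log M`. -/
def dimension (M : ℕ) (A : Finset (Fin M)) : ℝ :=
  Real.log A.card / Real.log M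

open Classical in
/-- The number of eigenvalues `λ` of `B_N`, `N = M ^ k`, with `|λ| ≥ M^{-ν}`, counted with
algebraic multiplicity. -/
def eigenvalueCount (M : ℕ) (A : Finset (Fin M)) (χ : ℝ → ℝ) (k : ℕ) (ν : ℝ) : ℕ :=
  ((bakerMap M A χ (M ^ k)).charpoly.roots.filter fun z : ℂ => (M : ℝ) ^ (-ν) ≤ ‖z‖).card

end OpenBaker

end

/-! Write `N = M ^ k`. The kernel of `B = B_N` at `(j, l + a N / M)` vanishes unless `a ∈ A`, and it
decays faster than any power of `|j - M l|`. One step of `B` therefore ties an output position `j`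
to the input position `j / M + a N / M`, which prepends the digit `a` in base `M`. Iterating `p = k
- s` times with `M ^ s ≈ N ^ η`, the power `C = B ^ p` satisfies `C = C Q + E`: here `Q` restricts
to the points within `M ^ s` of numbers whose `p` leading digits lie in `A`, at most `3 |A| ^ p M ^
s ≲ N ^ (δ + η)` points, and `E` is smaller in Hilbert–Schmidt norm than any fixed power of `N`.

Since the Fourier matrix `F` and the block diagonal factor of `B = Fᴴ D` are both symmetric, `F B =
Bᵀ F`. Transposing the localization turns it into localization on the output side, in frequency: `C
= J Jᴴ C + E₁` with `J = Fᴴ S`, `S` the inclusion of the localized functions.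

Hence `det (1 - z C)` factors as the nonvanishing `det (1 - z E₁)` times a determinant of size `rank
Q`, a perturbation of `det (1 - z Jᴴ C J)`. Eigenvalues of `B` with modulus at least `M ^ (-ν)` give
zeros of `det (1 - z C)` in a disk of radius at most `N ^ ν`, and a Jensen-type argument counts them
by the size of the small determinant on a disk of radius `R ≲ N ^ ν`. A bound by dimension gives `N
^ (δ + η) log N`. A Hilbert–Schmidt bound gives `R ^ 2 ‖C J‖²_HS`; up to the error, `C J` is `C S
(Sᴴ Fᴴ S)`, and the last factor has at most `N ^ (2 δ + 2 η)` entries (up to a constant), all of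
modulus `N ^ (-1/2)`. This produces the exponent `2 ν + 2 δ - 1`.

The two counts are `card_filter_eigenvalues_le_card` and `card_filter_eigenvalues_le_hsq`;
localization is `exists_hsq_localization_bound`, resting on the kernel decay
`exists_bakerMap_apply_bound`; `exists_eigenvalueCount_bound` joins them. -/

namespace OpenBaker

open scoped Matrix.Norms.L2Operator

set_option linter.unusedSectionVars false

/-! ### Hilbert–Schmidt norms and determinant bounds -/

section

open Polynomial (aeval)


variable {l m n : Type*} [Fintype l] [Fintype m] [Fintype n]

/-- The squared Hilbert–Schmidt norm of a matrix. -/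
noncomputable def hsq (A : Matrix m n ℂ) : ℝ := ∑ i, ∑ j, ‖A i j‖ ^ 2

lemma hsq_nonneg (A : Matrix m n ℂ) : 0 ≤ hsq A := by
  unfold hsq; positivity

lemma hsq_transpose (A : Matrix m n ℂ) : hsq Aᵀ = hsq A := by
  unfold hsq; rw [Finset.sum_comm]; rfl

lemma hsq_conjTranspose (A : Matrix m n ℂ) : hsq Aᴴ = hsq A := by
  unfold hsq; rw [Finset.sum_comm]; simp [Matrix.conjTranspose_apply]

lemma hsq_smul (c : ℂ) (A : Matrix m n ℂ) : hsq (c • A) = ‖c‖ ^ 2 * hsq A := by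
  simp [hsq, mul_pow, Finset.mul_sum]

lemma hsq_add_le (A B : Matrix m n ℂ) : hsq (A + B) ≤ 2 * hsq A + 2 * hsq B := by
  simp only [hsq, Finset.mul_sum, ← Finset.sum_add_distrib]
  gcongr with i _ j _
  have h := norm_add_le (A i j) (B i j)
  have h2 : ‖(A + B) i j‖ ^ 2 ≤ (‖A i j‖ + ‖B i j‖) ^ 2 := by
    rw [Matrix.add_apply]; gcongr
  nlinarith [sq_nonneg (‖A i j‖ - ‖B i j‖)]

lemma hsq_le_of_entry_le (A : Matrix m n ℂ) {b : ℝ} (h : ∀ i j, ‖A i j‖ ≤ b) :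
    hsq A ≤ Fintype.card m * Fintype.card n * b ^ 2 := by
  have : hsq A ≤ ∑ _i : m, ∑ _j : n, b ^ 2 := by
    unfold hsq
    gcongr with i _ j _
    exact h i j
  simpa [mul_assoc] using this

variable [DecidableEq l] [DecidableEq m] [DecidableEq n]

lemma hsq_mul_le (A : Matrix l m ℂ) (B : Matrix m n ℂ) :
    hsq (A * B) ≤ ‖A‖ ^ 2 * hsq B := by
  have key : ∀ j, ∑ i, ‖(A * B) i j‖ ^ 2 ≤ ‖A‖ ^ 2 * ∑ i, ‖B i j‖ ^ 2 := by
    intro j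
    have h := Matrix.l2_opNorm_mulVec A (WithLp.toLp 2 (fun i => B i j))
    have h2 := pow_le_pow_left₀ (norm_nonneg _) h 2
    rw [mul_pow, EuclideanSpace.norm_sq_eq, EuclideanSpace.norm_sq_eq] at h2
    simpa [Matrix.mulVec, Matrix.mul_apply, dotProduct] using h2
  unfold hsq
  rw [Finset.sum_comm, Finset.sum_comm (f := fun i j => ‖B i j‖ ^ 2), Finset.mul_sum]
  exact Finset.sum_le_sum fun j _ => key j

lemma hsq_mul_le' (A : Matrix l m ℂ) (B : Matrix m n ℂ) :
    hsq (A * B) ≤ hsq A * ‖B‖ ^ 2 := by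
  rw [← hsq_conjTranspose, Matrix.conjTranspose_mul, ← hsq_conjTranspose A,
    ← Matrix.l2_opNorm_conjTranspose B, mul_comm (hsq _)]
  exact hsq_mul_le _ _

lemma l2_opNorm_le_of_forall (A : Matrix m n ℂ) {c : ℝ} (hc : 0 ≤ c)
    (h : ∀ v : n → ℂ, ∑ i, ‖(A *ᵥ v) i‖ ^ 2 ≤ c ^ 2 * ∑ j, ‖v j‖ ^ 2) : ‖A‖ ≤ c := by
  rw [Matrix.l2_opNorm_def]
  refine ContinuousLinearMap.opNorm_le_bound _ hc fun v => ?_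
  refine le_of_sq_le_sq ?_ (by positivity)
  rw [mul_pow, EuclideanSpace.norm_sq_eq, EuclideanSpace.norm_sq_eq]
  simpa using h v.ofLp

lemma sq_norm_le_hsq (A : Matrix m n ℂ) : ‖A‖ ^ 2 ≤ hsq A := by
  have h : ‖A‖ ≤ Real.sqrt (hsq A) := by
    refine l2_opNorm_le_of_forall A (Real.sqrt_nonneg _) fun v => ?_
    rw [Real.sq_sqrt (hsq_nonneg A), hsq, Finset.sum_mul]
    refine Finset.sum_le_sum fun i _ => ?_
    calc ‖(A *ᵥ v) i‖ ^ 2 ≤ (∑ j, ‖A i j‖ * ‖v j‖) ^ 2 := by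
          gcongr
          simpa [Matrix.mulVec, dotProduct] using norm_sum_le Finset.univ fun j => A i j * v j
      _ ≤ _ := Finset.sum_mul_sq_le_sq_mul_sq _ _ _
  calc ‖A‖ ^ 2 ≤ Real.sqrt (hsq A) ^ 2 := by gcongr
    _ = _ := Real.sq_sqrt (hsq_nonneg A)

lemma hsq_one : hsq (1 : Matrix n n ℂ) = Fintype.card n := by
  have : ∀ i j : n, ‖(1 : Matrix n n ℂ) i j‖ ^ 2 = if i = j then 1 else 0 := by
    intro i j
    rw [Matrix.one_apply]
    split_ifs <;> simp
  simp [hsq, this]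

lemma l2_opNorm_one_le : ‖(1 : Matrix n n ℂ)‖ ≤ 1 :=
  l2_opNorm_le_of_forall _ zero_le_one (by simp)

lemma hsq_le_card (A : Matrix n n ℂ) : hsq A ≤ ‖A‖ ^ 2 * Fintype.card n := by
  calc hsq A = hsq (A * 1) := by rw [mul_one]
    _ ≤ ‖A‖ ^ 2 * hsq (1 : Matrix n n ℂ) := hsq_mul_le A 1
    _ = _ := by rw [hsq_one]

lemma l2_opNorm_pow_le_one (A : Matrix n n ℂ) (hA : ‖A‖ ≤ 1) (k : ℕ) : ‖A ^ k‖ ≤ 1 := by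
  induction k with
  | zero => simpa using l2_opNorm_one_le
  | succ k ih =>
    rw [pow_succ]
    exact (norm_mul_le _ _).trans (mul_le_one₀ ih (norm_nonneg _) hA)

lemma hsq_eq_trace (A : Matrix m n ℂ) : ((hsq A : ℝ) : ℂ) = (Aᴴ * A).trace := by
  simp only [hsq, Matrix.trace, Matrix.diag_apply, Matrix.mul_apply, Matrix.conjTranspose_apply]
  rw [Finset.sum_comm]
  push_cast
  refine Finset.sum_congr rfl fun i _ => Finset.sum_congr rfl fun j _ => ?_
  rw [← Complex.conj_mul']
  rfl

open scoped ComplexOrder in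
/-- A form of Hadamard's inequality. -/
lemma sq_norm_det_le (A : Matrix n n ℂ) :
    ‖A.det‖ ^ 2 ≤ Real.exp (hsq A - Fintype.card n) := by
  have hps := Matrix.posSemidef_conjTranspose_mul_self A
  have hH := hps.isHermitian
  have hdet : ((‖A.det‖ ^ 2 : ℝ) : ℂ) = ((∏ i, hH.eigenvalues i : ℝ) : ℂ) := by
    have h := hH.det_eq_prod_eigenvalues
    rw [Matrix.det_mul, Matrix.det_conjTranspose] at h
    push_cast
    rw [← Complex.conj_mul']
    simpa using h
  have htr : hsq A = ∑ i, hH.eigenvalues i := by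
    have h := hH.trace_eq_sum_eigenvalues
    rw [← hsq_eq_trace] at h
    have h' : ((hsq A : ℝ) : ℂ) = ((∑ i, hH.eigenvalues i : ℝ) : ℂ) := by simpa using h
    exact_mod_cast h'
  rw [Complex.ofReal_inj.mp hdet, htr]
  -- Applying `t ≤ exp (t - 1)` to each eigenvalue of `Aᴴ * A` replaces the arithmetic–geometric
  -- mean inequality.
  calc ∏ i, hH.eigenvalues i ≤ ∏ i, Real.exp (hH.eigenvalues i - 1) := by
        refine Finset.prod_le_prod (fun i _ => hps.eigenvalues_nonneg i) fun i _ => ?_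
        linarith [Real.add_one_le_exp (hH.eigenvalues i - 1)]
    _ = Real.exp (∑ i, hH.eigenvalues i - Fintype.card n) := by
        rw [← Real.exp_sum]; simp

lemma norm_det_le_pow (A : Matrix n n ℂ) {c : ℝ} (hc : 0 < c) (hA : ‖A‖ ≤ c) :
    ‖A.det‖ ≤ c ^ Fintype.card n := by
  have h := sq_norm_det_le (((c⁻¹ : ℝ) : ℂ) • A)
  rw [Matrix.det_smul, hsq_smul, norm_mul, norm_pow, Complex.norm_real, Real.norm_of_nonneg
    (by positivity)] at h
  have h1 : c⁻¹ ^ 2 * hsq A - Fintype.card n ≤ 0 := by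
    have : hsq A ≤ c ^ 2 * Fintype.card n := (hsq_le_card A).trans (by gcongr)
    have h2 : c⁻¹ ^ 2 * hsq A ≤ c⁻¹ ^ 2 * (c ^ 2 * Fintype.card n) := by gcongr
    rw [← mul_assoc, ← mul_pow, inv_mul_cancel₀ hc.ne', one_pow, one_mul] at h2
    linarith
  have h3 : (c⁻¹ ^ Fintype.card n * ‖A.det‖) ^ 2 ≤ 1 ^ 2 := by
    rw [one_pow]; exact h.trans (Real.exp_le_one_iff.mpr h1)
  have h4 := le_of_sq_le_sq h3 zero_le_one
  rwa [inv_pow, inv_mul_le_iff₀ (by positivity), mul_one] at h4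

/-- Hadamard's bound for `1 - W` alone would leave a term linear in `W`. Multiplying by `det (1 +
W)` cancels it through the parallelogram law, so only the Hilbert–Schmidt norm remains; the extra
factor equals `1` at `W = 0` and is harmless when counting zeros. -/
lemma norm_det_one_sub_mul_det_one_add_le (W : Matrix n n ℂ) :
    ‖(1 - W).det * (1 + W).det‖ ≤ Real.exp (hsq W) := by
  have par : hsq (1 - W) + hsq (1 + W) = 2 * Fintype.card n + 2 * hsq W := by
    rw [← hsq_one (n := n)]
    simp only [hsq, Finset.mul_sum, ← Finset.sum_add_distrib]
    refine Finset.sum_congr rfl fun i _ => Finset.sum_congr rfl fun j _ => ?_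
    have := parallelogram_law_with_norm ℝ ((1 : Matrix n n ℂ) i j) (W i j)
    simp only [Matrix.sub_apply, Matrix.add_apply]
    linarith
  refine le_of_sq_le_sq ?_ (Real.exp_pos _).le
  calc ‖(1 - W).det * (1 + W).det‖ ^ 2 = ‖(1 - W).det‖ ^ 2 * ‖(1 + W).det‖ ^ 2 := by
        rw [norm_mul, mul_pow]
    _ ≤ Real.exp (hsq (1 - W) - Fintype.card n) * Real.exp (hsq (1 + W) - Fintype.card n) := by
        gcongr <;> exact sq_norm_det_le _
    _ = Real.exp (hsq W) ^ 2 := by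
        rw [← Real.exp_add, ← Real.exp_nat_mul]
        congr 1
        push_cast
        linarith

/-- The determinant of a polynomial in `B` in terms of the eigenvalues of `B`. -/
lemma det_aeval (B : Matrix n n ℂ) (p : Polynomial ℂ) :
    (aeval B p).det = (B.charpoly.roots.map fun μ => p.eval μ).prod := by
  have hcard : B.charpoly.roots.card = Fintype.card n := by
    rw [Polynomial.splits_iff_card_roots.mp (IsAlgClosed.splits _),
      Matrix.charpoly_natDegree_eq_dim]
  have hlin : ∀ a : ℂ, (aeval B (Polynomial.X - Polynomial.C a)).det =
      (B.charpoly.roots.map fun μ => (Polynomial.X - Polynomial.C a).eval μ).prod := by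
    intro a
    have h1 : aeval B (Polynomial.X - Polynomial.C a) = -(Matrix.scalar n a - B) := by
      simp [Matrix.algebraMap_eq_diagonal, Matrix.scalar_apply]
    have h2 : B.charpoly.eval a = (B.charpoly.roots.map fun μ => a - μ).prod := by
      conv_lhs => rw [(IsAlgClosed.splits B.charpoly).eq_prod_roots_of_monic B.charpoly_monic]
      rw [Polynomial.eval_multiset_prod, Multiset.map_map]
      simp
    rw [h1, Matrix.det_neg, ← Matrix.eval_charpoly, h2, ← hcard, ← Multiset.card_map
      (fun μ => a - μ), ← Multiset.prod_map_neg, Multiset.map_map]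
    simp
  have hC : ∀ c : ℂ, (aeval B (Polynomial.C c)).det =
      (B.charpoly.roots.map fun μ => (Polynomial.C c).eval μ).prod := by
    intro c
    simp [Matrix.algebraMap_eq_diagonal, hcard]
  have hmul : ∀ s : Multiset ℂ,
      (aeval B (s.map fun a => Polynomial.X - Polynomial.C a).prod).det =
      (B.charpoly.roots.map fun μ =>
        ((s.map fun a => Polynomial.X - Polynomial.C a).prod).eval μ).prod := by
    intro s
    induction s using Multiset.induction with
    | empty => simp
    | cons a s ih =>
      simp only [Multiset.map_cons, Multiset.prod_cons, map_mul, Matrix.det_mul,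
        Polynomial.eval_mul, Multiset.prod_map_mul, ih, hlin]
  rw [(IsAlgClosed.splits p).eq_prod_roots]
  simp only [map_mul, Matrix.det_mul, Polynomial.eval_mul, Multiset.prod_map_mul, hmul, hC]

lemma det_one_sub_smul_pow (B : Matrix n n ℂ) (k : ℕ) (z : ℂ) :
    (1 - z • B ^ k).det = (B.charpoly.roots.map fun μ => 1 - z * μ ^ k).prod := by
  have := det_aeval B (1 - Polynomial.C z * Polynomial.X ^ k)
  simpa [Algebra.smul_def] using this

end

/-! ### Counting eigenvalues by the maximum principle -/

section

/-- Counting zeros of `∏ (1 - z μ)` in a disk by means of the maximum principle. -/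
lemma card_filter_le_of_factorization (s : Multiset ℂ) (f g h : ℂ → ℂ) {r L : ℝ} (hr : 0 < r)
    (hh : ∀ z, ‖z‖ ≤ (1 + Real.exp 1) * r → DifferentiableAt ℂ h z)
    (hg : ∀ z, ‖z‖ ≤ (1 + Real.exp 1) * r → DifferentiableAt ℂ g z)
    (h0 : ∀ z, ‖z‖ ≤ (1 + Real.exp 1) * r → h z ≠ 0)
    (hfac : ∀ z, ‖z‖ ≤ (1 + Real.exp 1) * r → (s.map fun μ => 1 - z * μ).prod = h z * f z)
    (hfg : ∀ z, ‖z‖ ≤ (1 + Real.exp 1) * r → ‖f z * g z‖ ≤ Real.exp L)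
    (hfg0 : f 0 * g 0 = 1) :
    ((s.filter fun μ => r⁻¹ ≤ ‖μ‖).card : ℝ) ≤ L := by
  classical
  set R := (1 + Real.exp 1) * r with hR
  have hRpos : 0 < R := by positivity
  set t := s.filter fun μ => r⁻¹ ≤ ‖μ‖ with ht
  set t' := s.filter fun μ => ¬ r⁻¹ ≤ ‖μ‖ with ht'
  have hst : t + t' = s := Multiset.filter_add_not _ _
  have hprod : ∀ z : ℂ, (s.map fun μ => 1 - z * μ).prod =
      (t.map fun μ => 1 - z * μ).prod * (t'.map fun μ => 1 - z * μ).prod := by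
    intro z; rw [← hst, Multiset.map_add, Multiset.prod_add]
  have hdiffprod : ∀ u : Multiset ℂ, Differentiable ℂ fun z => (u.map fun μ => 1 - z * μ).prod := by
    intro u
    induction u using Multiset.induction with
    | empty => simp
    | cons a u ih =>
      simp only [Multiset.map_cons, Multiset.prod_cons]
      fun_prop
  have hlow : ∀ u : Multiset ℂ, (∀ μ ∈ u, r⁻¹ ≤ ‖μ‖) → ∀ z : ℂ, ‖z‖ = R →
      Real.exp 1 ^ u.card ≤ ‖(u.map fun μ => 1 - z * μ).prod‖ := by
    intro u hu z hz
    induction u using Multiset.induction with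
    | empty => simp
    | cons a u ih =>
      simp only [Multiset.map_cons, Multiset.prod_cons, Multiset.card_cons, norm_mul]
      rw [pow_succ, mul_comm]
      -- The radius `(1 + e) r` is chosen for this: `‖z * a‖ ≥ 1 + e`, so each large eigenvalue
      -- contributes a factor of modulus at least `e` on the circle.
      have ha : Real.exp 1 ≤ ‖1 - z * a‖ := by
        have h1 : ‖z * a‖ - ‖(1 : ℂ)‖ ≤ ‖z * a - 1‖ := norm_sub_norm_le _ _
        rw [norm_sub_rev, norm_mul, hz, norm_one] at h1
        have h2 : R * r⁻¹ ≤ R * ‖a‖ := by gcongr; exact hu a (Multiset.mem_cons_self a u)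
        rw [hR, mul_assoc, mul_inv_cancel₀ hr.ne', mul_one, ← hR] at h2
        linarith
      exact mul_le_mul ha (ih fun μ hμ => hu μ (Multiset.mem_cons_of_mem hμ)) (by positivity)
        (norm_nonneg _)
  -- `G` is `f * g` divided by the factors of the large eigenvalues, written so that it is visibly
  -- holomorphic; no regularity of `f` is needed. On the circle it is at most `exp (L - t.card)`,
  -- while `G 0 = 1`.
  set G : ℂ → ℂ := fun z => (t'.map fun μ => 1 - z * μ).prod * g z / h z with hG
  have hGd : ∀ z, ‖z‖ ≤ R → DifferentiableAt ℂ G z := fun z hz =>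
    (((hdiffprod t') z).mul (hg z hz)).div (hh z hz) (h0 z hz)
  have hmax : ‖G 0‖ ≤ Real.exp (L - t.card) := by
    refine Complex.norm_le_of_forall_mem_frontier_norm_le (U := Metric.ball 0 R)
      Metric.isBounded_ball ?_ ?_ (subset_closure (Metric.mem_ball_self hRpos))
    · apply DifferentiableOn.diffContOnCl
      rw [closure_ball _ hRpos.ne']
      intro z hz
      exact (hGd z (by simpa using hz)).differentiableWithinAt
    · intro z hz
      rw [frontier_ball _ hRpos.ne'] at hz
      have hzR : ‖z‖ = R := by simpa using hz
      have h1 := hlow t (fun μ hμ => (Multiset.mem_filter.mp hμ).2) z hzR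
      have h2 : (t.map fun μ => 1 - z * μ).prod * G z = f z * g z := by
        have := hfac z hzR.le
        rw [hprod] at this
        have hz0 := h0 z hzR.le
        simp only [hG]
        field_simp
        rw [this]
        ring
      have h3 := hfg z hzR.le
      rw [← h2, norm_mul] at h3
      have h4 : Real.exp 1 ^ t.card * ‖G z‖ ≤ Real.exp L :=
        (mul_le_mul_of_nonneg_right h1 (norm_nonneg _)).trans h3
      rw [Real.exp_sub, le_div_iff₀ (Real.exp_pos _), mul_comm]
      rwa [← Real.exp_nat_mul, mul_one] at h4
  have hG0 : G 0 = 1 := by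
    have h1 := hfac 0 (by simpa using hRpos.le)
    simp only [zero_mul, sub_zero, Multiset.map_const', Multiset.prod_replicate, one_pow] at h1
    have h2 := h0 0 (by simpa using hRpos.le)
    simp only [hG, zero_mul, sub_zero, Multiset.map_const', Multiset.prod_replicate, one_pow,
      one_mul]
    rw [div_eq_one_iff_eq h2]
    linear_combination (g 0) * h1 + (h 0) * hfg0
  rw [hG0, norm_one, Real.one_le_exp_iff] at hmax
  linarith

variable {m n : Type*} [Fintype m] [Fintype n] [DecidableEq m] [DecidableEq n]

lemma differentiableAt_det {A : ℂ → Matrix n n ℂ} {z : ℂ}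
    (hA : ∀ i j, DifferentiableAt ℂ (fun w => A w i j) z) :
    DifferentiableAt ℂ (fun w => (A w).det) z := by
  simp only [Matrix.det_apply']
  fun_prop

lemma differentiableAt_inv_apply {A : ℂ → Matrix n n ℂ} {z : ℂ}
    (hA : ∀ i j, DifferentiableAt ℂ (fun w => A w i j) z) (h : (A z).det ≠ 0) (i j : n) :
    DifferentiableAt ℂ (fun w => (A w)⁻¹ i j) z := by
  simp only [Matrix.inv_def, Ring.inverse_eq_inv', Matrix.smul_apply, smul_eq_mul]
  refine ((differentiableAt_det hA).inv h).mul ?_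
  simp only [Matrix.adjugate_apply]
  refine differentiableAt_det fun a b => ?_
  by_cases hab : a = j
  · subst hab; simp
  · simp only [Matrix.updateRow_ne hab]; exact hA a b

lemma differentiableAt_mul_apply {l : Type*} {A : ℂ → Matrix l m ℂ} {B : ℂ → Matrix m n ℂ} {z : ℂ}
    (hA : ∀ i j, DifferentiableAt ℂ (fun w => A w i j) z)
    (hB : ∀ i j, DifferentiableAt ℂ (fun w => B w i j) z) (i : l) (j : n) :
    DifferentiableAt ℂ (fun w => (A w * B w) i j) z := by
  simp only [Matrix.mul_apply]
  fun_prop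

/-- If `‖E‖ ≤ 1/2`, then `1 - E` is invertible and the norm of its inverse is at most `2`. -/
lemma isUnit_one_sub_and_norm_inv_le (E : Matrix n n ℂ) (hE : ‖E‖ ≤ 1 / 2) :
    IsUnit (1 - E).det ∧ ‖(1 - E)⁻¹‖ ≤ 2 := by
  have hu : IsUnit (1 - E) := isUnit_one_sub_of_norm_lt_one (by linarith)
  have hu' := (Matrix.isUnit_iff_isUnit_det _).mp hu
  refine ⟨hu', ?_⟩
  have h1 : (1 - E)⁻¹ = 1 + E * (1 - E)⁻¹ := by
    have := Matrix.mul_nonsing_inv _ hu'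
    rw [sub_mul, one_mul] at this
    exact sub_eq_iff_eq_add.mp this
  have h2 : ‖(1 - E)⁻¹‖ ≤ 1 + 1 / 2 * ‖(1 - E)⁻¹‖ := by
    calc ‖(1 - E)⁻¹‖ = ‖1 + E * (1 - E)⁻¹‖ := by rw [← h1]
      _ ≤ ‖(1 : Matrix n n ℂ)‖ + ‖E * (1 - E)⁻¹‖ := norm_add_le _ _
      _ ≤ 1 + ‖E‖ * ‖(1 - E)⁻¹‖ := add_le_add l2_opNorm_one_le (norm_mul_le _ _)
      _ ≤ _ := by gcongr
  linarith

/-- Factor out `1 - z E`; the rest is the identity minus a product through the smaller index type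
`m`, and `det (1 - X Y) = det (1 - Y X)` reduces it to an `m × m` determinant. -/
lemma det_one_sub_smul_factor (C E : Matrix n n ℂ) (J : Matrix n m ℂ) (hC : C = J * (Jᴴ * C) + E)
    (z : ℂ) (hz : IsUnit (1 - z • E).det) :
    (1 - z • C).det =
      (1 - z • E).det * (1 - z • (Jᴴ * C * (1 - z • E)⁻¹ * J)).det := by
  have h1 : 1 - z • C = (1 - z • E) * (1 - ((1 - z • E)⁻¹ * J) * (z • (Jᴴ * C))) := by
    rw [mul_sub, mul_one, ← Matrix.mul_assoc, ← Matrix.mul_assoc, Matrix.mul_nonsing_inv _ hz,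
      Matrix.one_mul, Matrix.mul_smul]
    conv_lhs => rw [hC]
    rw [smul_add]; abel
  rw [h1, Matrix.det_mul, Matrix.det_one_sub_mul_comm]
  simp only [Matrix.smul_mul, Matrix.mul_assoc]

lemma one_sub_smul_entry_differentiableAt (E : Matrix n n ℂ) (i j : n) (z : ℂ) :
    DifferentiableAt ℂ (fun w : ℂ => (1 - w • E) i j) z := by
  simp only [Matrix.sub_apply, Matrix.smul_apply, smul_eq_mul]; fun_prop

lemma norm_smul_le_half {E : Matrix n n ℂ} {R : ℝ} (hE : R ^ 2 * hsq E ≤ 1 / 4) {z : ℂ}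
    (hz : ‖z‖ ≤ R) : ‖z • E‖ ≤ 1 / 2 := by
  refine le_of_sq_le_sq ?_ (by norm_num)
  calc ‖z • E‖ ^ 2 = ‖z‖ ^ 2 * ‖E‖ ^ 2 := by rw [norm_smul, mul_pow]
    _ ≤ R ^ 2 * hsq E := by gcongr; exact sq_norm_le_hsq E
    _ ≤ (1 / 2) ^ 2 := by linarith

/-- If `C` is almost invariant under the projection `J Jᴴ`, then the number of large eigenvalues of
`C` is controlled by the Hilbert–Schmidt norm of `C J`. -/
lemma card_filter_eigenvalues_le_hsq (C E : Matrix n n ℂ) (J : Matrix n m ℂ) (s : Multiset ℂ)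
    (hs : ∀ z : ℂ, (1 - z • C).det = (s.map fun μ => 1 - z * μ).prod)
    (hC1 : ‖C‖ ≤ 1) (hJ : ‖J‖ ≤ 1) (hC : C = J * (Jᴴ * C) + E) {r : ℝ} (hr : 0 < r)
    (hE : ((1 + Real.exp 1) * r) ^ 2 * hsq E ≤ 1 / 4) :
    ((s.filter fun μ => r⁻¹ ≤ ‖μ‖).card : ℝ) ≤ ((1 + Real.exp 1) * r) ^ 2 *
      (2 * hsq (C * J) + 8 * ((1 + Real.exp 1) * r) ^ 2 * hsq E) := by
  set R := (1 + Real.exp 1) * r with hR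
  have hunit : ∀ z : ℂ, ‖z‖ ≤ R → IsUnit (1 - z • E).det ∧ ‖(1 - z • E)⁻¹‖ ≤ 2 := fun z hz =>
    isUnit_one_sub_and_norm_inv_le _ (norm_smul_le_half hE hz)
  refine card_filter_le_of_factorization s
    (fun z => (1 - z • (Jᴴ * C * (1 - z • E)⁻¹ * J)).det)
    (fun z => (1 + z • (Jᴴ * C * (1 - z • E)⁻¹ * J)).det)
    (fun z => (1 - z • E).det) hr ?_ ?_ ?_ ?_ ?_ (by simp)
  · intro z _
    exact differentiableAt_det fun i j => one_sub_smul_entry_differentiableAt E i j z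
  · intro z hz
    refine differentiableAt_det fun i j => ?_
    simp only [Matrix.add_apply, Matrix.smul_apply, smul_eq_mul]
    have h1 : ∀ c d, DifferentiableAt ℂ (fun w => (1 - w • E)⁻¹ c d) z := fun c d =>
      differentiableAt_inv_apply (A := fun w => 1 - w • E)
        (fun a b => one_sub_smul_entry_differentiableAt E a b z) (hunit z hz).1.ne_zero c d
    have h2 : ∀ c d, DifferentiableAt ℂ (fun w => (Jᴴ * C * (1 - w • E)⁻¹) c d) z := fun c d =>
      differentiableAt_mul_apply (A := fun _ => Jᴴ * C) (B := fun w => (1 - w • E)⁻¹)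
        (fun _ _ => differentiableAt_const _) h1 c d
    have h3 : ∀ c d, DifferentiableAt ℂ (fun w => (Jᴴ * C * (1 - w • E)⁻¹ * J) c d) z := fun c d =>
      differentiableAt_mul_apply (A := fun w => Jᴴ * C * (1 - w • E)⁻¹) (B := fun _ => J)
        h2 (fun _ _ => differentiableAt_const _) c d
    exact (differentiableAt_const _).add (differentiableAt_id.mul (h3 i j))
  · exact fun z hz => (hunit z hz).1.ne_zero
  · exact fun z hz => by rw [← hs, det_one_sub_smul_factor C E J hC z (hunit z hz).1]
  · intro z hz
    refine (norm_det_one_sub_mul_det_one_add_le _).trans (Real.exp_le_exp.mpr ?_)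
    obtain ⟨hu, hinv⟩ := hunit z hz
    set S := (1 - z • E)⁻¹ with hS
    -- One step of the resolvent identity isolates `C * J`; the remainder carries a factor `E` and
    -- is small in Hilbert–Schmidt norm.
    have hSE : S = 1 + (z • E) * S := by
      have := Matrix.mul_nonsing_inv _ hu
      rw [sub_mul, one_mul] at this
      exact sub_eq_iff_eq_add.mp this
    have h1 : C * S * J = C * J + C * (z • E * (S * J)) := by
      conv_lhs => rw [hSE]
      simp only [Matrix.mul_add, Matrix.add_mul, Matrix.mul_assoc, Matrix.mul_one]
    have hJ' : ‖Jᴴ‖ ≤ 1 := by rwa [Matrix.l2_opNorm_conjTranspose]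
    have h2 : hsq (C * (z • E * (S * J))) ≤ 4 * R ^ 2 * hsq E := by
      have hSJ : ‖S * J‖ ≤ 2 := by
        calc ‖S * J‖ ≤ ‖S‖ * ‖J‖ := Matrix.l2_opNorm_mul _ _
          _ ≤ 2 * 1 := by gcongr
          _ = 2 := by norm_num
      calc hsq (C * (z • E * (S * J))) ≤ ‖C‖ ^ 2 * hsq (z • E * (S * J)) := hsq_mul_le _ _
        _ ≤ 1 ^ 2 * (hsq (z • E) * ‖S * J‖ ^ 2) := by
          gcongr
          · exact hsq_nonneg _
          · exact hsq_mul_le' _ _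
        _ ≤ 1 ^ 2 * ((R ^ 2 * hsq E) * 2 ^ 2) := by
          rw [hsq_smul]
          have := hsq_nonneg E
          gcongr
        _ = _ := by ring
    have h3 : hsq (C * S * J) ≤ 2 * hsq (C * J) + 8 * R ^ 2 * hsq E := by
      rw [h1]
      refine (hsq_add_le _ _).trans ?_
      linarith
    have h4 : Jᴴ * C * S * J = Jᴴ * (C * S * J) := by simp only [Matrix.mul_assoc]
    rw [hsq_smul, h4]
    have h5 : hsq (Jᴴ * (C * S * J)) ≤ 1 ^ 2 * hsq (C * S * J) :=
      (hsq_mul_le _ _).trans (by have := hsq_nonneg (C * S * J); gcongr)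
    have h6 := hsq_nonneg (Jᴴ * (C * S * J))
    gcongr
    linarith

/-- The reduced matrix has operator norm at most `2`, so on the disk its `m × m` determinant is at
most `(1 + 2 R) ^ card m`. No auxiliary factor is needed, hence `g = 1`. -/
lemma card_filter_eigenvalues_le_card (C E : Matrix n n ℂ) (J : Matrix n m ℂ) (s : Multiset ℂ)
    (hs : ∀ z : ℂ, (1 - z • C).det = (s.map fun μ => 1 - z * μ).prod)
    (hC1 : ‖C‖ ≤ 1) (hJ : ‖J‖ ≤ 1) (hC : C = J * (Jᴴ * C) + E) {r : ℝ} (hr : 0 < r)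
    (hE : ((1 + Real.exp 1) * r) ^ 2 * hsq E ≤ 1 / 4) :
    ((s.filter fun μ => r⁻¹ ≤ ‖μ‖).card : ℝ) ≤
      Fintype.card m * Real.log (1 + 2 * ((1 + Real.exp 1) * r)) := by
  set R := (1 + Real.exp 1) * r with hR
  have hRpos : 0 < R := by positivity
  have hunit : ∀ z : ℂ, ‖z‖ ≤ R → IsUnit (1 - z • E).det ∧ ‖(1 - z • E)⁻¹‖ ≤ 2 := fun z hz =>
    isUnit_one_sub_and_norm_inv_le _ (norm_smul_le_half hE hz)
  refine card_filter_le_of_factorization s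
    (fun z => (1 - z • (Jᴴ * C * (1 - z • E)⁻¹ * J)).det) (fun _ => 1)
    (fun z => (1 - z • E).det) hr ?_ (fun _ _ => differentiableAt_const _) ?_ ?_ ?_ (by simp)
  · intro z _
    exact differentiableAt_det fun i j => one_sub_smul_entry_differentiableAt E i j z
  · exact fun z hz => (hunit z hz).1.ne_zero
  · exact fun z hz => by rw [← hs, det_one_sub_smul_factor C E J hC z (hunit z hz).1]
  · intro z hz
    obtain ⟨hu, hinv⟩ := hunit z hz
    have hJ' : ‖Jᴴ‖ ≤ 1 := by rwa [Matrix.l2_opNorm_conjTranspose]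
    have h1 : ‖Jᴴ * C * (1 - z • E)⁻¹ * J‖ ≤ 2 := by
      calc ‖Jᴴ * C * (1 - z • E)⁻¹ * J‖ ≤ ‖Jᴴ * C * (1 - z • E)⁻¹‖ * ‖J‖ := Matrix.l2_opNorm_mul _ _
        _ ≤ (‖Jᴴ * C‖ * ‖(1 - z • E)⁻¹‖) * ‖J‖ := by gcongr; exact Matrix.l2_opNorm_mul _ _
        _ ≤ ((‖Jᴴ‖ * ‖C‖) * ‖(1 - z • E)⁻¹‖) * ‖J‖ := by gcongr; exact Matrix.l2_opNorm_mul _ _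
        _ ≤ ((1 * 1) * 2) * 1 := by gcongr
        _ = 2 := by norm_num
    have h2 : ‖1 - z • (Jᴴ * C * (1 - z • E)⁻¹ * J)‖ ≤ 1 + 2 * R := by
      calc _ ≤ ‖(1 : Matrix m m ℂ)‖ + ‖z • (Jᴴ * C * (1 - z • E)⁻¹ * J)‖ := norm_sub_le _ _
        _ ≤ 1 + R * 2 := by
          rw [norm_smul]
          have := l2_opNorm_one_le (n := m)
          gcongr
        _ = _ := by ring
    rw [mul_one, Real.exp_nat_mul, Real.exp_log (by positivity)]
    exact norm_det_le_pow _ (by positivity) h2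

end

/-! ### Discrete nonstationary phase: finite differences and summation by parts -/

lemma abs_fwdDiff_iter_le {h : ℝ} (hh : 0 ≤ h) (n : ℕ) : ∀ {f : ℝ → ℝ} {K : ℝ}, ContDiff ℝ ∞ f →
    (∀ x, |iteratedDeriv n f x| ≤ K) → ∀ x, |(fwdDiff h)^[n] f x| ≤ h ^ n * K := by
  induction n with
  | zero => intro f K _ hK x; simpa using hK x
  | succ n ih =>
    intro f K hf hK x
    have hshift : ContDiff ℝ ∞ fun y => f (y + h) := hf.comp (contDiff_id.add contDiff_const)
    have hd : ∀ y, iteratedDeriv n (fwdDiff h f) y =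
        iteratedDeriv n f (y + h) - iteratedDeriv n f y := by
      intro y
      have h1 : fwdDiff h f = (fun y => f (y + h)) - f := by ext; simp [fwdDiff]
      rw [h1, iteratedDeriv_sub (hshift.contDiffAt.of_le (by exact_mod_cast le_top))
        (hf.contDiffAt.of_le (by exact_mod_cast le_top)), iteratedDeriv_comp_add_const]
    have hb : ∀ y, |iteratedDeriv n (fwdDiff h f) y| ≤ h * K := by
      intro y
      rw [hd]
      have hdiff : Differentiable ℝ (iteratedDeriv n f) :=
        hf.differentiable_iteratedDeriv n (by exact_mod_cast WithTop.coe_lt_top n)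
      have := Convex.norm_image_sub_le_of_norm_deriv_le (s := Set.univ) (f := iteratedDeriv n f)
        (C := K) (fun z _ => hdiff z) (fun z _ => by
          rw [← iteratedDeriv_succ]; exact hK z) convex_univ (Set.mem_univ y)
          (Set.mem_univ (y + h))
      simpa [abs_of_nonneg hh, mul_comm] using this
    have := ih (f := fwdDiff h f) (hshift.sub hf) hb x
    rw [Function.iterate_succ_apply]
    calc _ ≤ _ := this
      _ = _ := by ring

lemma fwdDiff_iter_sample (f : ℝ → ℝ) (h : ℝ) (n : ℕ) (m : ℤ) :
    (fwdDiff (1 : ℤ))^[n] (fun m : ℤ => ((f (m * h) : ℝ) : ℂ)) m =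
      (((fwdDiff h)^[n] f (m * h) : ℝ) : ℂ) := by
  induction n generalizing f with
  | zero => simp
  | succ n ih =>
    rw [Function.iterate_succ_apply, Function.iterate_succ_apply, ← ih]
    refine congrArg (fun g : ℤ → ℂ => (fwdDiff (1 : ℤ))^[n] g m) ?_
    funext m
    simp [fwdDiff, add_mul]

lemma fwdDiff_iter_eq_zero {f : ℤ → ℂ} {a : ℤ} (hf : ∀ m, m ∉ Set.Icc 0 a → f m = 0) (n : ℕ) :
    ∀ m : ℤ, m ∉ Set.Icc (-(n : ℤ)) a → (fwdDiff (1 : ℤ))^[n] f m = 0 := by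
  induction n with
  | zero => simpa using hf
  | succ n ih =>
    intro m hm
    rw [Function.iterate_succ_apply', fwdDiff, ih, ih, sub_zero]
    · simp only [Set.mem_Icc, Nat.cast_succ] at hm ⊢; omega
    · simp only [Set.mem_Icc, Nat.cast_succ] at hm ⊢; omega

lemma summable_of_eq_zero_off_Icc {f : ℤ → ℂ} {a b : ℤ} (hf : ∀ m, m ∉ Set.Icc a b → f m = 0) :
    Summable f :=
  summable_of_ne_finset_zero (s := Finset.Icc a b) fun m hm => hf m (by simpa using hm)

/-- Summation by parts. -/
lemma pow_mul_tsum_zpow {f : ℤ → ℂ} {a : ℤ} (hf : ∀ m, m ∉ Set.Icc 0 a → f m = 0) {w : ℂ}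
    (hw : w ≠ 0) (n : ℕ) :
    (w⁻¹ - 1) ^ n * ∑' m : ℤ, f m * w ^ m = ∑' m : ℤ, (fwdDiff (1 : ℤ))^[n] f m * w ^ m := by
  induction n with
  | zero => simp
  | succ n ih =>
    set g := (fwdDiff (1 : ℤ))^[n] f with hg
    have hg0 := fwdDiff_iter_eq_zero hf n
    have hs : Summable fun m : ℤ => g m * w ^ m :=
      summable_of_eq_zero_off_Icc (a := -(n : ℤ)) (b := a) fun m hm => by rw [hg, hg0 m hm, zero_mul]
    have hs' : Summable fun m : ℤ => g (m + 1) * w ^ m := by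
      refine summable_of_eq_zero_off_Icc (a := -(n : ℤ) - 1) (b := a) fun m hm => ?_
      rw [hg, hg0 (m + 1), zero_mul]
      simp only [Set.mem_Icc] at hm ⊢; omega
    have hshift : ∑' m : ℤ, g (m + 1) * w ^ m = w⁻¹ * ∑' m : ℤ, g m * w ^ m := by
      rw [← (Equiv.addRight (1 : ℤ)).tsum_eq (fun m => g m * w ^ m), ← tsum_mul_left]
      refine tsum_congr fun m => ?_
      simp only [Equiv.coe_addRight]
      rw [zpow_add₀ hw, zpow_one]
      field_simp
    rw [pow_succ', mul_assoc, ih, Function.iterate_succ_apply', sub_mul, one_mul, ← hshift,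
      ← hs'.tsum_sub hs]
    refine tsum_congr fun m => ?_
    rw [fwdDiff, sub_mul]

/-- Jordan's inequality on each half of `[0, 1 - c]`; near `1` the sine vanishes again, and the
margin `c` keeps it bounded below. It bounds `‖w⁻¹ - 1‖` from below in the summation by parts. -/
lemma abs_sin_pi_mul_ge {c x : ℝ} (hc : 0 < c) (hc1 : c ≤ 1) (hx : |x| ≤ 1 - c) :
    2 * c * |x| ≤ |Real.sin (Real.pi * x)| := by
  have hpi := Real.pi_pos
  have key : ∀ y : ℝ, 0 ≤ y → y ≤ 1 - c → 2 * c * y ≤ Real.sin (Real.pi * y) := by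
    intro y hy0 hy1
    rcases le_total y (1 / 2) with h | h
    · have := Real.mul_le_sin (x := Real.pi * y) (by positivity) (by nlinarith)
      rw [← mul_assoc, div_mul_cancel₀ _ hpi.ne'] at this
      nlinarith
    · have := Real.mul_le_sin (x := Real.pi * (1 - y)) (mul_nonneg hpi.le (by linarith))
        (by nlinarith)
      rw [← mul_assoc, div_mul_cancel₀ _ hpi.ne', mul_one_sub, mul_one_sub,
        Real.sin_pi_sub] at this
      nlinarith
  have h1 := key |x| (abs_nonneg x) hx
  refine h1.trans ?_
  rcases abs_cases x with ⟨h, _⟩ | ⟨h, _⟩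
  · rw [h]; exact le_abs_self _
  · rw [h, mul_neg, Real.sin_neg]; exact neg_le_abs _

lemma IsCutoff.exists_margin {χ : ℝ → ℝ} (hχ : IsCutoff χ) :
    ∃ c : ℝ, 0 < c ∧ c ≤ 1 ∧ ∀ x, χ x ≠ 0 → c ≤ x ∧ x ≤ 1 - c := by
  have hK : IsCompact (tsupport χ) := hχ.hasCompactSupport
  obtain ⟨d, hd, hdsub⟩ := hK.exists_cthickening_subset_open isOpen_Ioo hχ.tsupport_subset
  refine ⟨min d 1, by positivity, min_le_right _ _, fun x hx => ?_⟩
  have hx' : x ∈ tsupport χ := subset_tsupport χ hx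
  have hmem : ∀ y : ℝ, |y - x| ≤ d → y ∈ Set.Ioo (0 : ℝ) 1 := fun y hy =>
    hdsub (Metric.mem_cthickening_of_dist_le y x d _ hx' (by rwa [Real.dist_eq]))
  have h1 := hmem (x - d) (by simp [abs_of_pos hd])
  have h2 := hmem (x + d) (by simp [abs_of_pos hd])
  have h3 := min_le_left d 1
  exact ⟨by linarith [h1.1], by linarith [h2.2]⟩

lemma IsCutoff.exists_iteratedDeriv_bound {χ : ℝ → ℝ} (hχ : IsCutoff χ) (n : ℕ) :
    ∃ K : ℝ, 0 ≤ K ∧ ∀ x, |iteratedDeriv n χ x| ≤ K := by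
  have hcont : Continuous (iteratedDeriv n χ) :=
    hχ.smooth.continuous_iteratedDeriv n (by exact_mod_cast le_top)
  have hsupp : HasCompactSupport (iteratedDeriv n χ) := by
    induction n with
    | zero => simpa using hχ.hasCompactSupport
    | succ n ih =>
      rw [iteratedDeriv_succ]
      exact (ih (hχ.smooth.continuous_iteratedDeriv n (by exact_mod_cast le_top))).deriv
  obtain ⟨K, hK⟩ := hcont.bounded_above_of_compact_support hsupp
  exact ⟨K, (norm_nonneg _).trans (hK 0), fun x => hK x⟩

/-- Rapid decay of the discrete Fourier transform of a cutoff. -/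
lemma IsCutoff.exists_sum_bound {χ : ℝ → ℝ} (hχ : IsCutoff χ) {c : ℝ} (hc : 0 < c) (hc1 : c ≤ 1)
    (hχ0 : ∀ x, χ x ≠ 0 → c ≤ x ∧ x ≤ 1 - c) {M : ℕ} (hM : 0 < M) (n : ℕ) :
    ∃ K : ℝ, 0 ≤ K ∧ ∀ N : ℕ, 0 < N → ∀ t : ℤ, t ≠ 0 → |(t : ℝ)| ≤ (1 - c) * (M * N) →
      ‖∑ m : Fin N, ((χ ((m : ℕ) / N) : ℝ) : ℂ) *
        Complex.exp (2 * Real.pi * Complex.I * (m : ℕ) * t / (M * N))‖ ≤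
        K * N * (|(t : ℝ)| ^ n)⁻¹ := by
  obtain ⟨K, hK0, hK⟩ := hχ.exists_iteratedDeriv_bound n
  -- The `n`-th difference is supported on at most `N + n + 1 ≤ (n + 2) N` points and is at most `K
  -- / N ^ n`; dividing by `(4 c |t| / (M N)) ^ n`, a lower bound for `‖w⁻¹ - 1‖ ^ n`, cancels `N ^
  -- n` and leaves `(M / (4 c)) ^ n`.
  refine ⟨(n + 2) * K * (M / (4 * c)) ^ n, by positivity, fun N hN t ht htN => ?_⟩
  have hNr : (0 : ℝ) < N := by exact_mod_cast hN
  have hMr : (0 : ℝ) < M := by exact_mod_cast hM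
  have htr : 0 < |(t : ℝ)| := by positivity
  set θ : ℝ := 2 * Real.pi * t / (M * N) with hθ
  set w : ℂ := Complex.exp (Complex.I * θ) with hw
  have hw0 : w ≠ 0 := Complex.exp_ne_zero _
  have hwn : ‖w‖ = 1 := by rw [hw, mul_comm]; exact Complex.norm_exp_ofReal_mul_I θ
  set f : ℤ → ℂ := fun m => ((χ (m * (1 / N : ℝ)) : ℝ) : ℂ) with hf
  have hfpos : ∀ m : ℤ, f m ≠ 0 → 0 < m ∧ m < N := by
    intro m hm
    have h1 : χ (m * (1 / N : ℝ)) ≠ 0 := by simpa [hf] using hm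
    obtain ⟨h2, h3⟩ := hχ0 _ h1
    rw [mul_one_div] at h2 h3
    constructor
    · have : (0 : ℝ) < m := by
        have := (lt_div_iff₀ hNr).mp (hc.trans_le h2); simpa using this
      exact_mod_cast this
    · have : (m : ℝ) < N := by
        have := (div_lt_iff₀ hNr).mp (lt_of_le_of_lt h3 (by linarith : 1 - c < 1)); simpa using this
      exact_mod_cast this
  have hf0 : ∀ m, m ∉ Set.Icc (0 : ℤ) N → f m = 0 := by
    intro m hm
    by_contra h
    have := hfpos m h
    exact hm ⟨this.1.le, this.2.le⟩
  have hsum : ∑ m : Fin N, ((χ ((m : ℕ) / N) : ℝ) : ℂ) *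
      Complex.exp (2 * Real.pi * Complex.I * (m : ℕ) * t / (M * N)) = ∑' m : ℤ, f m * w ^ m := by
    rw [tsum_eq_sum (s := (Finset.range N).map Nat.castEmbedding), Finset.sum_map,
      ← Fin.sum_univ_eq_sum_range (fun m => f (Nat.castEmbedding m) * w ^ (Nat.castEmbedding m : ℤ)) N]
    · refine Finset.sum_congr rfl fun m _ => ?_
      congr 1
      · simp [hf, div_eq_mul_inv]
      · simp only [Nat.castEmbedding_apply, zpow_natCast]
        rw [hw, ← Complex.exp_nat_mul]
        congr 1
        rw [hθ]; push_cast; ring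
    · intro m hm
      rw [mul_eq_zero]
      left
      by_contra h
      obtain ⟨h1, h2⟩ := hfpos m h
      refine hm (Finset.mem_map.mpr ⟨m.toNat, Finset.mem_range.mpr (by omega), ?_⟩)
      simp only [Nat.castEmbedding_apply]; omega
  have hparts := pow_mul_tsum_zpow hf0 hw0 n
  have hright : ‖∑' m : ℤ, (fwdDiff (1 : ℤ))^[n] f m * w ^ m‖ ≤
      (n + 2) * N * ((1 / N : ℝ) ^ n * K) := by
    rw [tsum_eq_sum (s := Finset.Icc (-(n : ℤ)) N) (fun m hm => by
      rw [fwdDiff_iter_eq_zero hf0 n m (by simpa using hm), zero_mul])]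
    have hb : ∀ m ∈ Finset.Icc (-(n : ℤ)) N, ‖(fwdDiff (1 : ℤ))^[n] f m * w ^ m‖ ≤
        (1 / N : ℝ) ^ n * K := by
      intro m _
      rw [norm_mul, norm_zpow, hwn, one_zpow, mul_one, hf, fwdDiff_iter_sample, Complex.norm_real]
      exact abs_fwdDiff_iter_le (by positivity) n hχ.smooth hK _
    refine (norm_sum_le_of_le _ hb).trans ?_
    rw [Finset.sum_const, nsmul_eq_mul, Int.card_Icc]
    gcongr
    have h1 : (((N : ℤ) + 1 - -(n : ℤ)).toNat : ℝ) = N + 1 + n := by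
      have : ((N : ℤ) + 1 - -(n : ℤ)).toNat = N + 1 + n := by omega
      rw [this]; push_cast; ring
    rw [h1]
    have : (1 : ℝ) ≤ N := by exact_mod_cast hN
    have hn0 : (0 : ℝ) ≤ n := by positivity
    nlinarith
  have hlow : 4 * c * |(t : ℝ)| / (M * N) ≤ ‖w⁻¹ - 1‖ := by
    have h1 : w⁻¹ - 1 = -(w⁻¹ * (w - 1)) := by field_simp; ring
    rw [h1, norm_neg, norm_mul, norm_inv, hwn, inv_one, one_mul, hw,
      Complex.norm_exp_I_mul_ofReal_sub_one, norm_mul, Real.norm_ofNat, Real.norm_eq_abs]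
    have h2 : θ / 2 = Real.pi * (t / (M * N)) := by rw [hθ]; ring
    have h3 : |(t : ℝ) / (M * N)| = |(t : ℝ)| / (M * N) := by
      rw [abs_div, abs_of_pos (by positivity : (0 : ℝ) < M * N)]
    have h4 := abs_sin_pi_mul_ge hc hc1 (x := t / (M * N)) (by
      rw [h3, div_le_iff₀ (by positivity)]; exact htN)
    rw [h3] at h4
    rw [h2]
    calc _ = 2 * (2 * c * (|(t : ℝ)| / (M * N))) := by ring
      _ ≤ _ := by gcongr
  rw [hsum]
  set S := ∑' m : ℤ, f m * w ^ m
  have h5 : (4 * c * |(t : ℝ)| / (M * N)) ^ n * ‖S‖ ≤ (n + 2) * N * ((1 / N : ℝ) ^ n * K) := by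
    refine le_trans ?_ hright
    rw [← hparts, norm_mul, norm_pow]
    gcongr
  rw [mul_comm, ← le_div_iff₀ (by positivity)] at h5
  refine h5.trans (le_of_eq ?_)
  simp only [div_pow, mul_pow, one_pow]
  field_simp

/-! ### The Fourier transform and the kernel of the baker's map -/

lemma dft_transpose (N : ℕ) : (dft N)ᵀ = dft N := by
  ext i j
  simp only [dft, Matrix.transpose_apply, Matrix.of_apply]
  congr 3
  ring

lemma norm_dft_apply (N : ℕ) (i j : Fin N) : ‖dft N i j‖ = 1 / Real.sqrt N := by
  have h : -(2 * Real.pi * Complex.I * (i : ℕ) * (j : ℕ) / N : ℂ) =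
      ((-(2 * Real.pi * (i : ℕ) * (j : ℕ) / N) : ℝ) : ℂ) * Complex.I := by
    push_cast; ring
  rw [dft, Matrix.of_apply, norm_mul, h, Complex.norm_exp_ofReal_mul_I, mul_one, Complex.norm_real,
    Real.norm_of_nonneg (by positivity)]

lemma star_dft_apply (N : ℕ) (i j : Fin N) : star (dft N i j) =
    ((1 / Real.sqrt N : ℝ) : ℂ) *
      Complex.exp (2 * Real.pi * Complex.I * (i : ℕ) * (j : ℕ) / N) := by
  simp only [dft, Matrix.of_apply, star_mul', RCLike.star_def, Complex.conj_ofReal,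
    ← Complex.exp_conj]
  congr 2
  simp [neg_div, map_ofNat]

lemma dft_conjTranspose_mul_self {N : ℕ} (hN : 0 < N) : (dft N)ᴴ * dft N = 1 := by
  have hNr : (0 : ℝ) < N := by exact_mod_cast hN
  have hNc : (N : ℂ) ≠ 0 := by exact_mod_cast hN.ne'
  have hs : (((1 / Real.sqrt N : ℝ) : ℂ)) * ((1 / Real.sqrt N : ℝ) : ℂ) = (N : ℂ)⁻¹ := by
    rw [← Complex.ofReal_mul, div_mul_div_comm, Real.mul_self_sqrt hNr.le]; simp
  ext j j'
  set w : ℂ := Complex.exp (2 * Real.pi * Complex.I * ((j : ℕ) - (j' : ℕ)) / N) with hw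
  have hterm : ∀ l : Fin N, (dft N)ᴴ j l * dft N l j' = (N : ℂ)⁻¹ * w ^ (l : ℕ) := by
    intro l
    rw [Matrix.conjTranspose_apply, star_dft_apply, dft, Matrix.of_apply, mul_mul_mul_comm, hs,
      ← Complex.exp_add, hw, ← Complex.exp_nat_mul]
    congr 2
    ring
  rw [Matrix.mul_apply, Finset.sum_congr rfl fun l _ => hterm l, ← Finset.mul_sum,
    Fin.sum_univ_eq_sum_range (fun l => w ^ l) N]
  by_cases hjj : j = j'
  · subst hjj
    simp [hw, hNc]
  · rw [Matrix.one_apply_ne hjj]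
    have hwN : w ^ N = 1 := by
      rw [hw, ← Complex.exp_nat_mul, Complex.exp_eq_one_iff]
      refine ⟨(j : ℤ) - (j' : ℤ), ?_⟩
      push_cast
      field_simp
    have hw1 : w ≠ 1 := by
      intro h
      rw [hw, Complex.exp_eq_one_iff] at h
      obtain ⟨n, hn⟩ := h
      have hpi : (2 * Real.pi * Complex.I : ℂ) ≠ 0 := Complex.two_pi_I_ne_zero
      have h1 : (((j : ℕ) : ℂ) - (j' : ℕ)) = n * N := by
        field_simp at hn
        linear_combination hn
      have h2 : ((j : ℕ) : ℤ) - ((j' : ℕ) : ℤ) = n * N := by exact_mod_cast h1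
      have hj := j.isLt
      have hj' := j'.isLt
      have h3 : n < 1 := by
        by_contra hn1
        nlinarith
      have h4 : -1 < n := by
        by_contra hn1
        nlinarith
      have h5 : n = 0 := by omega
      rw [h5] at h2
      exact hjj (Fin.ext (by omega))
    have := geom_sum_mul w N
    rw [hwN, sub_self] at this
    rw [(mul_eq_zero.mp this).resolve_right (sub_ne_zero.mpr hw1), mul_zero]

lemma dft_mul_conjTranspose {N : ℕ} (hN : 0 < N) : dft N * (dft N)ᴴ = 1 :=
  mul_eq_one_comm.mp (dft_conjTranspose_mul_self hN)

lemma l2_opNorm_le_one_of_conjTranspose_mul_self {m n : Type*} [Fintype m] [Fintype n]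
    [DecidableEq m] [DecidableEq n] {A : Matrix m n ℂ} (h : Aᴴ * A = 1) : ‖A‖ ≤ 1 := by
  have h1 := Matrix.l2_opNorm_conjTranspose_mul_self A
  rw [h] at h1
  have h2 : ‖A‖ * ‖A‖ ≤ 1 := h1 ▸ l2_opNorm_one_le
  nlinarith [norm_nonneg A]

lemma norm_dft_le_one {N : ℕ} (hN : 0 < N) : ‖dft N‖ ≤ 1 :=
  l2_opNorm_le_one_of_conjTranspose_mul_self (dft_conjTranspose_mul_self hN)

lemma norm_cutoff_le_one {χ : ℝ → ℝ} (hχ : ∀ x, χ x ∈ Set.Icc (0 : ℝ) 1) (N : ℕ) :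
    ‖cutoff χ N‖ ≤ 1 := by
  rw [cutoff, Matrix.l2_opNorm_diagonal, pi_norm_le_iff_of_nonneg zero_le_one]
  intro i
  rw [Complex.norm_real, Real.norm_of_nonneg (hχ _).1]
  exact (hχ _).2

section Blocks

variable {M N : ℕ}

/-- The index `i + a N / M` in `{0, …, N - 1}`. -/
def blockIndex (hMN : M ∣ N) (a : Fin M) (i : Fin (N / M)) : Fin N :=
  ⟨i + a * (N / M), by
    have h1 := i.isLt
    have h2 : (a : ℕ) + 1 ≤ M := a.isLt
    calc (i : ℕ) + a * (N / M) < (a + 1) * (N / M) := by rw [add_mul, one_mul]; omega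
      _ ≤ M * (N / M) := Nat.mul_le_mul_right _ h2
      _ = N := Nat.mul_div_cancel' hMN⟩

lemma blockIndex_inj (hMN : M ∣ N) {a b : Fin M} {i j : Fin (N / M)}
    (h : blockIndex hMN a i = blockIndex hMN b j) : a = b ∧ i = j := by
  have h1 : (i : ℕ) + a * (N / M) = j + b * (N / M) := congrArg Fin.val h
  have hi := i.isLt
  have hj := j.isLt
  have hpos : 0 < N / M := by omega
  have h2 : (a : ℕ) = b := by
    have := congrArg (· / (N / M)) h1
    simpa [Nat.add_mul_div_right _ _ hpos, Nat.div_eq_of_lt hi, Nat.div_eq_of_lt hj] using this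
  rw [h2] at h1
  exact ⟨Fin.ext h2, Fin.ext (by omega)⟩

lemma exists_blockIndex (hMN : M ∣ N) (x : Fin N) : ∃ a i, blockIndex hMN a i = x := by
  have hx := x.isLt
  have hN : M * (N / M) = N := Nat.mul_div_cancel' hMN
  have hpos : 0 < N / M := Nat.pos_of_ne_zero fun h => by rw [h] at hN; omega
  refine ⟨⟨x / (N / M), ?_⟩, ⟨x % (N / M), Nat.mod_lt _ hpos⟩, Fin.ext (Nat.mod_add_div' _ _)⟩
  rw [Nat.div_lt_iff_lt_mul hpos, hN]
  exact hx

lemma sum_blockIndex (hMN : M ∣ N) (f : Fin N → ℝ) :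
    ∑ a, ∑ i, f (blockIndex hMN a i) = ∑ x, f x := by
  rw [← Fintype.sum_prod_type']
  refine Function.Bijective.sum_comp (e := fun p : Fin M × Fin (N / M) => blockIndex hMN p.1 p.2)
    ⟨fun p q h => ?_, fun x => ?_⟩ f
  · exact Prod.ext (blockIndex_inj hMN h).1 (blockIndex_inj hMN h).2
  · obtain ⟨a, i, h⟩ := exists_blockIndex hMN x
    exact ⟨(a, i), h⟩

lemma proj_apply (hMN : M ∣ N) (a : Fin M) (i : Fin (N / M)) (x : Fin N) :
    proj M N a i x = if x = blockIndex hMN a i then 1 else 0 := by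
  simp [proj, blockIndex, Fin.ext_iff]

lemma proj_mulVec (hMN : M ∣ N) (a : Fin M) (v : Fin N → ℂ) (i : Fin (N / M)) :
    (proj M N a *ᵥ v) i = v (blockIndex hMN a i) := by
  simp [Matrix.mulVec, dotProduct, proj_apply hMN]

lemma proj_conjTranspose (a : ℕ) : (proj M N a)ᴴ = (proj M N a)ᵀ := by
  ext i j
  simp only [Matrix.conjTranspose_apply, Matrix.transpose_apply, proj, Matrix.of_apply]
  split_ifs <;> simp

lemma proj_mul_proj_conjTranspose (hMN : M ∣ N) (a b : Fin M) :
    proj M N b * (proj M N a)ᴴ = if a = b then 1 else 0 := by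
  ext i j
  rw [proj_conjTranspose, Matrix.mul_apply]
  simp only [Matrix.transpose_apply, proj_apply hMN, ite_mul, one_mul, zero_mul,
    Finset.sum_ite_eq', Finset.mem_univ, if_true]
  by_cases hab : a = b
  · subst hab
    rw [if_pos rfl, Matrix.one_apply]
    congr 1
    exact propext ⟨fun h => (blockIndex_inj hMN h).2, fun h => by rw [h]⟩
  · rw [if_neg hab, if_neg fun h => hab (blockIndex_inj hMN h).1.symm, Matrix.zero_apply]

end Blocks

/-- The block diagonal part of the baker's map: `B_N = F_N^* D`. -/
noncomputable def blockPart (M : ℕ) (A : Finset (Fin M)) (χ : ℝ → ℝ) (N : ℕ) :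
    Matrix (Fin N) (Fin N) ℂ :=
  ∑ a ∈ A, (proj M N a)ᴴ * (cutoff χ (N / M) * dft (N / M) * cutoff χ (N / M)) * proj M N a

section Baker

variable {M N : ℕ} (A : Finset (Fin M)) (χ : ℝ → ℝ)

lemma bakerMap_eq : bakerMap M A χ N = (dft N)ᴴ * blockPart M A χ N := by
  simp only [bakerMap, blockPart, Matrix.mul_sum, Matrix.mul_assoc]

lemma blockPart_transpose : (blockPart M A χ N)ᵀ = blockPart M A χ N := by
  simp only [blockPart, Matrix.transpose_sum, Matrix.transpose_mul, proj_conjTranspose,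
    Matrix.transpose_transpose, dft_transpose, cutoff, Matrix.diagonal_transpose, Matrix.mul_assoc]

/-- With `B = Fᴴ D`, both sides equal `D`, because `F` is unitary and `F`, `D` are symmetric. This
symmetry converts localization in position into localization in frequency. -/
lemma dft_mul_bakerMap (hN : 0 < N) :
    dft N * bakerMap M A χ N = (bakerMap M A χ N)ᵀ * dft N := by
  have h : ((dft N)ᴴ)ᵀ = (dft N)ᴴ := by
    rw [Matrix.conjTranspose, ← Matrix.transpose_map, Matrix.transpose_transpose, dft_transpose]
  rw [bakerMap_eq, ← Matrix.mul_assoc, dft_mul_conjTranspose hN, Matrix.one_mul,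
    Matrix.transpose_mul, blockPart_transpose, h, Matrix.mul_assoc, dft_conjTranspose_mul_self hN,
    Matrix.mul_one]

variable {χ}

lemma proj_mul_blockPart (hMN : M ∣ N) (b : Fin M) : proj M N b * blockPart M A χ N =
    if b ∈ A then cutoff χ (N / M) * dft (N / M) * cutoff χ (N / M) * proj M N b else 0 := by
  simp only [blockPart, Matrix.mul_sum, ← Matrix.mul_assoc]
  simp only [proj_mul_proj_conjTranspose hMN]
  rw [← Finset.sum_ite_eq' A b fun a => cutoff χ (N / M) * dft (N / M) * cutoff χ (N / M) *
    proj M N a]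
  refine Finset.sum_congr rfl fun a _ => ?_
  by_cases h : a = b <;> simp [h, Matrix.mul_assoc]

lemma norm_blockPart_le_one (hχ : ∀ x, χ x ∈ Set.Icc (0 : ℝ) 1) (hMN : M ∣ N) (hN : 0 < N / M) :
    ‖blockPart M A χ N‖ ≤ 1 := by
  set K := cutoff χ (N / M) * dft (N / M) * cutoff χ (N / M) with hK
  have hK1 : ‖K‖ ≤ 1 := by
    calc ‖K‖ ≤ ‖cutoff χ (N / M) * dft (N / M)‖ * ‖cutoff χ (N / M)‖ := norm_mul_le _ _
      _ ≤ (‖cutoff χ (N / M)‖ * ‖dft (N / M)‖) * ‖cutoff χ (N / M)‖ := by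
        gcongr; exact norm_mul_le _ _
      _ ≤ (1 * 1) * 1 := by
        have := norm_cutoff_le_one hχ (N / M)
        have := norm_dft_le_one hN
        gcongr
      _ = 1 := by norm_num
  refine l2_opNorm_le_of_forall _ zero_le_one fun v => ?_
  rw [one_pow, one_mul, ← sum_blockIndex hMN, ← sum_blockIndex hMN]
  refine Finset.sum_le_sum fun b _ => ?_
  simp only [← proj_mulVec hMN b (blockPart M A χ N *ᵥ v)]
  rw [Matrix.mulVec_mulVec, proj_mul_blockPart A hMN]
  by_cases hb : b ∈ A
  · rw [if_pos hb, ← Matrix.mulVec_mulVec, ← hK]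
    have h := Matrix.l2_opNorm_mulVec K (WithLp.toLp 2 (proj M N b *ᵥ v))
    have h2 := pow_le_pow_left₀ (norm_nonneg _) h 2
    rw [mul_pow, EuclideanSpace.norm_sq_eq, EuclideanSpace.norm_sq_eq] at h2
    refine (by simpa using h2 : _ ≤ ‖K‖ ^ 2 * ∑ i, ‖(proj M N b *ᵥ v) i‖ ^ 2).trans ?_
    simp only [proj_mulVec hMN]
    exact mul_le_of_le_one_left (by positivity) (pow_le_one₀ (norm_nonneg _) hK1)
  · rw [if_neg hb]
    exact (by simp : _ = (0 : ℝ)).trans_le (by positivity)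

lemma norm_bakerMap_le_one (hχ : ∀ x, χ x ∈ Set.Icc (0 : ℝ) 1) (hMN : M ∣ N) (hN : 0 < N / M) :
    ‖bakerMap M A χ N‖ ≤ 1 := by
  have hN0 : 0 < N := Nat.pos_of_ne_zero fun h => by simp [h] at hN
  rw [bakerMap_eq]
  refine (norm_mul_le _ _).trans (mul_le_one₀ ?_ (norm_nonneg _)
    (norm_blockPart_le_one A hχ hMN hN))
  rw [Matrix.l2_opNorm_conjTranspose]
  exact norm_dft_le_one hN0

lemma bakerMap_apply (hMN : M ∣ N) (j : Fin N) (a : Fin M) (i : Fin (N / M)) :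
    bakerMap M A χ N j (blockIndex hMN a i) = if a ∈ A then
      ∑ m, star (dft N (blockIndex hMN a m) j) *
        ((χ ((m : ℕ) / (N / M : ℕ)) : ℂ) * dft (N / M) m i * (χ ((i : ℕ) / (N / M : ℕ)) : ℂ))
      else 0 := by
  rw [bakerMap, Matrix.sum_apply, ← Finset.sum_ite_eq' A a fun a => ∑ m,
    star (dft N (blockIndex hMN a m) j) *
    ((χ ((m : ℕ) / (N / M : ℕ)) : ℂ) * dft (N / M) m i * (χ ((i : ℕ) / (N / M : ℕ)) : ℂ))]
  refine Finset.sum_congr rfl fun b _ => ?_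
  rw [Matrix.mul_apply]
  by_cases hb : b = a
  · subst hb
    rw [if_pos rfl, Finset.sum_eq_single i]
    · rw [proj_apply hMN, if_pos rfl, mul_one, Matrix.mul_apply]
      refine Finset.sum_congr rfl fun m _ => ?_
      congr 1
      · rw [proj_conjTranspose, Matrix.mul_apply]
        simp only [Matrix.transpose_apply, proj_apply hMN, mul_ite, mul_one, mul_zero,
          Finset.sum_ite_eq', Finset.mem_univ, if_true, Matrix.conjTranspose_apply]
      · simp only [cutoff, Matrix.mul_diagonal, Matrix.diagonal_mul]
    · intro i' _ hi'
      rw [proj_apply hMN, if_neg fun h => hi' (blockIndex_inj hMN h).2.symm, mul_zero]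
    · simp
  · rw [if_neg hb]
    refine Finset.sum_eq_zero fun i' _ => ?_
    rw [proj_apply hMN, if_neg fun h => hb (blockIndex_inj hMN h).1.symm, mul_zero]

/-- Off-diagonal decay of the kernel of the baker's map. -/
lemma exists_bakerMap_apply_bound (hχ : IsCutoff χ) (hM : 0 < M) (n : ℕ) :
    ∃ K : ℝ, 0 ≤ K ∧ ∀ N : ℕ, ∀ hMN : M ∣ N, ∀ (j : Fin N) (a : Fin M) (i : Fin (N / M)),
      ((j : ℕ) : ℤ) - M * (i : ℕ) ≠ 0 →
      ‖bakerMap M A χ N j (blockIndex hMN a i)‖ ≤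
        K * (|(((j : ℕ) : ℤ) - M * (i : ℕ) : ℤ)| ^ n : ℝ)⁻¹ := by
  obtain ⟨c, hc, hc1, hχ0⟩ := hχ.exists_margin
  obtain ⟨K, hK, hsum⟩ := hχ.exists_sum_bound hc hc1 hχ0 hM n
  refine ⟨K, hK, fun N hMN j a i ht => ?_⟩
  have hpos : 0 < N / M := i.pos
  have hNeq : ((M : ℕ) : ℝ) * ((N / M : ℕ) : ℝ) = N := by exact_mod_cast Nat.mul_div_cancel' hMN
  have hNeqc : ((M : ℕ) : ℂ) * ((N / M : ℕ) : ℂ) = N := by exact_mod_cast Nat.mul_div_cancel' hMN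
  have hMr : (0 : ℝ) < M := by exact_mod_cast hM
  have hPr : (0 : ℝ) < (N / M : ℕ) := by exact_mod_cast hpos
  have hPc : ((N / M : ℕ) : ℂ) ≠ 0 := by exact_mod_cast hpos.ne'
  have hMc : (M : ℂ) ≠ 0 := by exact_mod_cast hM.ne'
  rw [bakerMap_apply A hMN]
  split_ifs with ha
  swap
  · rw [norm_zero]; positivity
  by_cases hi : χ ((i : ℕ) / (N / M : ℕ)) = 0
  · simp only [hi, Complex.ofReal_zero, mul_zero, Finset.sum_const_zero, norm_zero]
    positivity
  set t : ℤ := ((j : ℕ) : ℤ) - M * (i : ℕ) with hteq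
  obtain ⟨hi1, hi2⟩ := hχ0 _ hi
  -- The cutoff in `i` forces `c N ≤ M i ≤ (1 - c) N`, while `0 ≤ j ≤ N`. Hence `j - M i` stays away
  -- from `±N` and there is no aliasing.
  have htN : |(t : ℝ)| ≤ (1 - c) * (M * (N / M : ℕ)) := by
    rw [le_div_iff₀ hPr] at hi1
    rw [div_le_iff₀ hPr] at hi2
    have hj : ((j : ℕ) : ℝ) ≤ M * (N / M : ℕ) := by rw [hNeq]; exact_mod_cast j.isLt.le
    have hj0 : (0 : ℝ) ≤ (j : ℕ) := by positivity
    have h1 := mul_le_mul_of_nonneg_left hi1 hMr.le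
    have h2 := mul_le_mul_of_nonneg_left hi2 hMr.le
    rw [hteq, abs_le]
    push_cast
    constructor <;> nlinarith
  have hb := hsum (N / M) hpos t ht htN
  have hterm : ∀ m : Fin (N / M), star (dft N (blockIndex hMN a m) j) *
      ((χ ((m : ℕ) / (N / M : ℕ)) : ℂ) * dft (N / M) m i * (χ ((i : ℕ) / (N / M : ℕ)) : ℂ)) =
      (((1 / Real.sqrt N : ℝ) : ℂ) * ((1 / Real.sqrt (N / M : ℕ) : ℝ) : ℂ) *
        (χ ((i : ℕ) / (N / M : ℕ)) : ℂ) *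
        Complex.exp (((2 * Real.pi * a * j / M : ℝ) : ℂ) * Complex.I)) *
      ((χ ((m : ℕ) / (N / M : ℕ)) : ℂ) *
        Complex.exp (2 * Real.pi * Complex.I * (m : ℕ) * t / (M * (N / M : ℕ)))) := by
    intro m
    rw [star_dft_apply, dft, Matrix.of_apply]
    -- The phase `(m + a N / M) j / N - m i / (N / M)` splits into `a j / M`, independent of `m`,
    -- and `m (j - M i) / N`.
    have hexp : Complex.exp (2 * Real.pi * Complex.I * (blockIndex hMN a m : ℕ) * (j : ℕ) / N) *
        Complex.exp (-(2 * Real.pi * Complex.I * (m : ℕ) * (i : ℕ) / (N / M : ℕ))) =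
        Complex.exp (((2 * Real.pi * a * j / M : ℝ) : ℂ) * Complex.I) *
        Complex.exp (2 * Real.pi * Complex.I * (m : ℕ) * t / (M * (N / M : ℕ))) := by
      rw [← Complex.exp_add, ← Complex.exp_add]
      congr 1
      rw [← hNeqc, hteq, blockIndex]
      push_cast
      field_simp
      ring
    linear_combination (((1 / Real.sqrt N : ℝ) : ℂ) * ((1 / Real.sqrt (N / M : ℕ) : ℝ) : ℂ) *
      (χ ((i : ℕ) / (N / M : ℕ)) : ℂ) * (χ ((m : ℕ) / (N / M : ℕ)) : ℂ)) * hexp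
  rw [Finset.sum_congr rfl fun m _ => hterm m, ← Finset.mul_sum, norm_mul, norm_mul, norm_mul,
    norm_mul, Complex.norm_exp_ofReal_mul_I, mul_one, Complex.norm_real, Complex.norm_real,
    Complex.norm_real, Real.norm_of_nonneg (hχ.mem_Icc _).1, Real.norm_of_nonneg (by positivity),
    Real.norm_of_nonneg (by positivity)]
  have hsq : 1 / Real.sqrt N * (1 / Real.sqrt (N / M : ℕ)) * (N / M : ℕ) ≤ 1 := by
    have h1 : Real.sqrt (N / M : ℕ) ≤ Real.sqrt N :=
      Real.sqrt_le_sqrt (by exact_mod_cast Nat.div_le_self N M)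
    have h2 : 0 < Real.sqrt (N / M : ℕ) := Real.sqrt_pos.mpr hPr
    have h3 : 0 < Real.sqrt N := h2.trans_le h1
    rw [div_mul_div_comm, one_mul, div_mul_eq_mul_div, div_le_one (by positivity), one_mul]
    nth_rewrite 1 [← Real.mul_self_sqrt hPr.le]
    gcongr
  calc _ ≤ 1 / Real.sqrt N * (1 / Real.sqrt (N / M : ℕ)) * 1 *
        (K * (N / M : ℕ) * (|(t : ℝ)| ^ n)⁻¹) := by
        gcongr
        exact (hχ.mem_Icc _).2
    _ = (1 / Real.sqrt N * (1 / Real.sqrt (N / M : ℕ)) * (N / M : ℕ)) *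
        (K * (|(t : ℝ)| ^ n)⁻¹) := by ring
    _ ≤ 1 * (K * (|(t : ℝ)| ^ n)⁻¹) := by gcongr
    _ = _ := by rw [one_mul]; push_cast; rfl

lemma bakerMap_apply_of_notMem (hMN : M ∣ N) (j : Fin N) {a : Fin M} (ha : a ∉ A)
    (i : Fin (N / M)) : bakerMap M A χ N j (blockIndex hMN a i) = 0 := by
  rw [bakerMap_apply, if_neg ha]

end Baker

/-! ### Digit words and propagation of localization -/

/-- Numbers with `i` digits in base `M`, all of which belong to `A`. -/
def words (M : ℕ) (A : Finset (Fin M)) : ℕ → Finset ℕ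
  | 0 => {0}
  | i + 1 => (A ×ˢ words M A i).image fun p => (p.1 : ℕ) * M ^ i + p.2

lemma card_words_le (M : ℕ) (A : Finset (Fin M)) (i : ℕ) : (words M A i).card ≤ A.card ^ i := by
  induction i with
  | zero => simp [words]
  | succ i ih =>
    rw [words, pow_succ']
    refine Finset.card_image_le.trans ?_
    rw [Finset.card_product]
    exact Nat.mul_le_mul_left _ ih

/-- `x` is within `M ^ s` of a number whose first `i` digits (out of `k`) are in `A`. -/
def IsNear (M : ℕ) (A : Finset (Fin M)) (k s i x : ℕ) : Prop :=
  ∃ w ∈ words M A i, w * M ^ (k - i) ≤ x + M ^ s ∧ x < w * M ^ (k - i) + M ^ (k - i) + M ^ s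

lemma isNear_zero {M : ℕ} (A : Finset (Fin M)) {k s x : ℕ} (hx : x < M ^ k) :
    IsNear M A k s 0 x :=
  ⟨0, by simp [words], by simp, by simp; omega⟩

/-- Since `l` is close to `j / M`, it lies near the interval of `w` shrunk by `M`; adding `a M ^ k /
M` makes `a` the new leading digit. -/
lemma isNear_succ {M : ℕ} (hM : 2 ≤ M) {A : Finset (Fin M)} {k s i j l : ℕ} (hi : i + 1 ≤ k)
    (hj : IsNear M A k s i j) {a : Fin M} (ha : a ∈ A)
    (hjl : |(j : ℤ) - M * l| < M ^ s) : IsNear M A k s (i + 1) (l + a * (M ^ k / M)) := by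
  obtain ⟨w, hw, h1, h2⟩ := hj
  refine ⟨a * M ^ i + w, ?_, ?_⟩
  · rw [words]
    exact Finset.mem_image.mpr ⟨(a, w), Finset.mk_mem_product ha hw, rfl⟩
  have hdiv : M ^ k / M = M ^ i * M ^ (k - (i + 1)) := by
    rw [← pow_add]
    have : k = (i + (k - (i + 1))) + 1 := by omega
    conv_lhs => rw [this, pow_succ]
    exact Nat.mul_div_cancel _ (by omega)
  have hpow : M ^ (k - i) = M * M ^ (k - (i + 1)) := by
    rw [← pow_succ']; congr 1; omega
  rw [hdiv]
  rw [hpow] at h1 h2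
  set P := M ^ (k - (i + 1))
  set r := M ^ s with hr
  rw [abs_lt] at hjl
  obtain ⟨h3, h4⟩ := hjl
  have h3' : M * l < j + r := by
    have : ((M * l : ℕ) : ℤ) < ((j + r : ℕ) : ℤ) := by rw [hr]; push_cast; linarith
    exact_mod_cast this
  have h4' : j < M * l + r := by
    have : ((j : ℕ) : ℤ) < ((M * l + r : ℕ) : ℤ) := by rw [hr]; push_cast; linarith
    exact_mod_cast this
  -- The old tolerance `r` and the new error `r` add up to `2 r`, and division by `M ≥ 2` brings
  -- this back to `r`. The neighbourhood therefore does not grow under iteration.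
  have hMr : 2 * r ≤ M * r := Nat.mul_le_mul_right _ hM
  have h5 : w * P ≤ l + r := by
    refine Nat.le_of_mul_le_mul_left (c := M) ?_ (by omega)
    calc M * (w * P) = w * (M * P) := by ring
      _ ≤ M * l + M * r := by omega
      _ = _ := by ring
  have h6 : l < w * P + P + r := by
    refine Nat.lt_of_mul_lt_mul_left (a := M) ?_
    calc M * l < w * (M * P) + M * P + M * r := by omega
      _ = _ := by ring
  constructor
  · calc (a * M ^ i + w) * P = a * (M ^ i * P) + w * P := by ring
      _ ≤ _ := by omega
  · calc l + a * (M ^ i * P) < a * (M ^ i * P) + (w * P + P + r) := by omega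
      _ = _ := by ring

lemma card_fin_interval_le (N a b r : ℕ) :
    (Finset.univ.filter fun x : Fin N => a ≤ (x : ℕ) + r ∧ (x : ℕ) < a + b + r).card ≤
      b + 2 * r := by
  rw [← Finset.card_map Fin.valEmbedding]
  calc _ ≤ (Finset.Ico (a - r) (a + b + r)).card := by
        refine Finset.card_le_card fun y hy => ?_
        simp only [Finset.mem_map, Finset.mem_filter, Finset.mem_univ, true_and,
          Fin.valEmbedding_apply] at hy
        obtain ⟨x, ⟨h1, h2⟩, rfl⟩ := hy
        rw [Finset.mem_Ico]
        omega
    _ ≤ _ := by rw [Nat.card_Ico]; omega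

-- At length `k - s` the word intervals have length `M ^ s`, equal to the tolerance, so each word
-- accounts for at most `3 M ^ s` points.
open Classical in
lemma card_isNear_le {M : ℕ} (A : Finset (Fin M)) {k s : ℕ} (hs : s ≤ k) :
    Fintype.card {x : Fin (M ^ k) // IsNear M A k s (k - s) x} ≤ 3 * A.card ^ (k - s) * M ^ s := by
  rw [Fintype.card_subtype]
  have hks : k - (k - s) = s := by omega
  calc _ ≤ ((words M A (k - s)).biUnion fun w => Finset.univ.filter fun x : Fin (M ^ k) =>
        w * M ^ s ≤ (x : ℕ) + M ^ s ∧ (x : ℕ) < w * M ^ s + M ^ s + M ^ s).card := by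
        refine Finset.card_le_card fun x hx => ?_
        simp only [Finset.mem_filter, Finset.mem_univ, true_and, Finset.mem_biUnion] at hx ⊢
        obtain ⟨w, hw, h⟩ := hx
        rw [hks] at h
        exact ⟨w, hw, h⟩
    _ ≤ (words M A (k - s)).card * (M ^ s + 2 * M ^ s) :=
        Finset.card_biUnion_le_card_mul _ _ _ fun w _ => card_fin_interval_le _ _ _ _
    _ ≤ A.card ^ (k - s) * (M ^ s + 2 * M ^ s) := Nat.mul_le_mul_right _ (card_words_le M A _)
    _ = _ := by ring

open Classical in
/-- The orthogonal projection onto functions supported near words of length `i`. -/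
noncomputable def nearProj (M : ℕ) (A : Finset (Fin M)) (k s i : ℕ) :
    Matrix (Fin (M ^ k)) (Fin (M ^ k)) ℂ :=
  Matrix.diagonal fun x => if IsNear M A k s i x then 1 else 0

section Localization

variable {M : ℕ} (A : Finset (Fin M)) {χ : ℝ → ℝ} (k s : ℕ)

lemma nearProj_zero : nearProj M A k s 0 = 1 := by
  rw [nearProj, ← Matrix.diagonal_one]
  congr 1
  ext x
  rw [if_pos (isNear_zero A x.isLt)]

lemma nearProj_transpose (i : ℕ) : (nearProj M A k s i)ᵀ = nearProj M A k s i := by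
  rw [nearProj, Matrix.diagonal_transpose]

lemma one_sub_nearProj (i : ℕ) [∀ x, Decidable (IsNear M A k s i x)] : 1 - nearProj M A k s i =
    Matrix.diagonal fun x : Fin (M ^ k) => if IsNear M A k s i x then 0 else 1 := by
  rw [nearProj, ← Matrix.diagonal_one, Matrix.diagonal_sub]
  congr 1
  ext x
  split_ifs <;> simp

lemma norm_one_sub_nearProj_le (i : ℕ) : ‖1 - nearProj M A k s i‖ ≤ 1 := by
  classical
  rw [one_sub_nearProj, Matrix.l2_opNorm_diagonal, pi_norm_le_iff_of_nonneg zero_le_one]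
  intro x
  split_ifs <;> simp

/-- Propagation of localization by one step of the map. -/
lemma exists_hsq_step_bound (hM : 2 ≤ M) (hχ : IsCutoff χ) (n : ℕ) :
    ∃ K : ℝ, 0 ≤ K ∧ ∀ k s i : ℕ, i + 1 ≤ k →
      hsq (nearProj M A k s i * bakerMap M A χ (M ^ k) * (1 - nearProj M A k s (i + 1))) ≤
        ((M : ℝ) ^ k) ^ 2 * (K * (((M : ℝ) ^ s) ^ n)⁻¹) ^ 2 := by
  classical
  obtain ⟨K, hK, hb⟩ := exists_bakerMap_apply_bound A hχ (by omega : 0 < M) n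
  refine ⟨K, hK, fun k s i hi => ?_⟩
  have hMN : M ∣ M ^ k := dvd_pow_self M (by omega)
  have hMr : (0 : ℝ) < M := by exact_mod_cast (by omega : 0 < M)
  refine (hsq_le_of_entry_le _ (b := K * (((M : ℝ) ^ s) ^ n)⁻¹) fun j x => ?_).trans
    (le_of_eq ?_)
  swap
  · simp only [Fintype.card_fin]; push_cast; ring
  rw [one_sub_nearProj, nearProj, Matrix.mul_diagonal, Matrix.diagonal_mul]
  have hnn : 0 ≤ K * (((M : ℝ) ^ s) ^ n)⁻¹ := by positivity
  by_cases hj : IsNear M A k s i j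
  swap
  · simpa [hj] using hnn
  by_cases hx : IsNear M A k s (i + 1) x
  · simpa [hx] using hnn
  rw [if_pos hj, if_neg hx, one_mul, mul_one]
  obtain ⟨a, l, rfl⟩ := exists_blockIndex hMN x
  by_cases ha : a ∈ A
  swap
  · rw [bakerMap_apply_of_notMem A hMN j ha, norm_zero]; exact hnn
  have ht : (M : ℤ) ^ s ≤ |((j : ℕ) : ℤ) - M * (l : ℕ)| := by
    by_contra h
    exact hx (isNear_succ hM hi hj ha (not_le.mp h))
  have hpos : (0 : ℤ) < (M : ℤ) ^ s := by positivity
  refine (hb _ hMN j a l (abs_pos.mp (hpos.trans_le ht))).trans ?_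
  have ht' : (M : ℝ) ^ s ≤ ((|(((j : ℕ) : ℤ) - M * (l : ℕ) : ℤ)| : ℤ) : ℝ) := by exact_mod_cast ht
  gcongr

/-- Telescoping over the steps, with `‖B‖ ≤ 1` so that earlier errors are not amplified. The factor
`2 ^ (i + 1)`, due to `hsq_add_le`, is at most a power of `N` and is absorbed by the rapid decay. -/
lemma exists_hsq_localization_bound (hM : 2 ≤ M) (hχ : IsCutoff χ) (n : ℕ) :
    ∃ K : ℝ, 0 ≤ K ∧ ∀ k s i : ℕ, i ≤ k →
      hsq (bakerMap M A χ (M ^ k) ^ i * (1 - nearProj M A k s i)) ≤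
        2 ^ (i + 1) * (((M : ℝ) ^ k) ^ 2 * (K * (((M : ℝ) ^ s) ^ n)⁻¹) ^ 2) := by
  obtain ⟨K, hK, hstep⟩ := exists_hsq_step_bound A hM hχ n
  refine ⟨K, hK, fun k s i hi => ?_⟩
  set g : ℝ := ((M : ℝ) ^ k) ^ 2 * (K * (((M : ℝ) ^ s) ^ n)⁻¹) ^ 2 with hg
  have hg0 : 0 ≤ g := by positivity
  -- The coefficients `2 ^ (i + 1) - 2` solve `a₀ = 0`, `aᵢ₊₁ = 2 + 2 aᵢ`, which is the recursion
  -- given by `hsq_add_le`.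
  suffices h : hsq (bakerMap M A χ (M ^ k) ^ i * (1 - nearProj M A k s i)) ≤
      (2 ^ (i + 1) - 2) * g by linarith
  induction i with
  | zero =>
    rw [nearProj_zero, sub_self, mul_zero]
    simp [hsq]
  | succ i ih =>
    have hMN : M ∣ M ^ k := dvd_pow_self M (by omega)
    have hN : 0 < M ^ k / M := Nat.div_pos (Nat.le_of_dvd (by positivity) hMN) (by omega)
    set B := bakerMap M A χ (M ^ k) with hB
    have hB1 : ‖B‖ ≤ 1 := norm_bakerMap_le_one A hχ.mem_Icc hMN hN
    set Q := nearProj M A k s i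
    set Q' := nearProj M A k s (i + 1)
    have h1 : B ^ (i + 1) * (1 - Q') = B ^ i * (Q * B * (1 - Q')) +
        B ^ i * (1 - Q) * (B * (1 - Q')) := by
      rw [pow_succ]; noncomm_ring
    have h2 : hsq (B ^ i * (Q * B * (1 - Q'))) ≤ g := by
      refine (hsq_mul_le _ _).trans ?_
      refine (mul_le_of_le_one_left (hsq_nonneg _) (pow_le_one₀ (norm_nonneg _)
        (l2_opNorm_pow_le_one B hB1 i))).trans (hstep k s i hi)
    have h3 : hsq (B ^ i * (1 - Q) * (B * (1 - Q'))) ≤ (2 ^ (i + 1) - 2) * g := by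
      refine (hsq_mul_le' _ _).trans ?_
      refine (mul_le_of_le_one_right (hsq_nonneg _) (pow_le_one₀ (norm_nonneg _) ?_)).trans
        (ih (by omega))
      exact (norm_mul_le _ _).trans (mul_le_one₀ hB1 (norm_nonneg _)
        (norm_one_sub_nearProj_le A k s (i + 1)))
    rw [h1]
    refine (hsq_add_le _ _).trans ?_
    calc _ ≤ 2 * g + 2 * ((2 ^ (i + 1) - 2) * g) := by gcongr
      _ = _ := by ring

end Localization

/-! ### Passage to a long power and choice of exponents -/

open Classical in
/-- The eigenvalue count is bounded by the number of large eigenvalues of a power. -/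
lemma eigenvalueCount_le (M : ℕ) (hM : 0 < M) (A : Finset (Fin M)) (χ : ℝ → ℝ) (k p : ℕ) (ν : ℝ) :
    eigenvalueCount M A χ k ν ≤
      (((bakerMap M A χ (M ^ k)).charpoly.roots.map fun μ => μ ^ p).filter
        fun μ => (((M : ℝ) ^ ν) ^ p)⁻¹ ≤ ‖μ‖).card := by
  rw [eigenvalueCount, Multiset.filter_map, Multiset.card_map]
  refine Multiset.card_le_card (Multiset.monotone_filter_right _ fun μ hμ => ?_)
  simp only [Function.comp_apply, norm_pow]
  rw [← inv_pow, ← Real.rpow_neg (by positivity)]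
  gcongr

-- Both counts are applied to `C = B ^ (k - s)`. Here `e` bounds the squared localization error, `R`
-- is the radius of the disk and `x` bounds the number of localized points.
open Classical in
lemma exists_eigenvalueCount_bound {M : ℕ} (hM : 2 ≤ M) (A : Finset (Fin M)) {χ : ℝ → ℝ}
    (hχ : IsCutoff χ) (n : ℕ) : ∃ K : ℝ, 0 ≤ K ∧ ∀ (k s : ℕ) (ν e R x : ℝ), s < k →
      e = 2 ^ (k - s + 1) * (((M : ℝ) ^ k) ^ 2 * (K * (((M : ℝ) ^ s) ^ n)⁻¹) ^ 2) →
      R = (1 + Real.exp 1) * ((M : ℝ) ^ ν) ^ (k - s) →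
      x = 3 * (A.card : ℝ) ^ (k - s) * (M : ℝ) ^ s →
      R ^ 2 * e ≤ 1 / 4 →
      (eigenvalueCount M A χ k ν : ℝ) ≤
          R ^ 2 * (2 * (2 * (x ^ 2 / (M : ℝ) ^ k) + 2 * e) + 8 * R ^ 2 * e) ∧
        (eigenvalueCount M A χ k ν : ℝ) ≤ x * Real.log (1 + 2 * R) := by
  obtain ⟨K, hK, hloc⟩ := exists_hsq_localization_bound A hM hχ n
  refine ⟨K, hK, fun k s ν e R x hsk he hR hx hRe => ?_⟩
  have hMN : M ∣ M ^ k := dvd_pow_self M (by omega)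
  have hNpos : 0 < M ^ k := by positivity
  have hN : 0 < M ^ k / M := Nat.div_pos (Nat.le_of_dvd hNpos hMN) (by omega)
  have hMr : (0 : ℝ) < M := by exact_mod_cast (by omega : 0 < M)
  set p := k - s with hp
  set B := bakerMap M A χ (M ^ k) with hB
  set F := dft (M ^ k) with hF
  set Q := nearProj M A k s p with hQ
  set C := B ^ p with hCdef
  set E := C * (1 - Q) with hE
  have hB1 : ‖B‖ ≤ 1 := norm_bakerMap_le_one A hχ.mem_Icc hMN hN
  have hC1 : ‖C‖ ≤ 1 := l2_opNorm_pow_le_one B hB1 p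
  have hEe : hsq E ≤ e := by rw [he]; exact hloc k s p (by omega)
  have hF1 : ‖F‖ ≤ 1 := norm_dft_le_one hNpos
  have hFs1 : ‖Fᴴ‖ ≤ 1 := by rwa [Matrix.l2_opNorm_conjTranspose]
  have hFF : Fᴴ * F = 1 := dft_conjTranspose_mul_self hNpos
  let X := {x : Fin (M ^ k) // IsNear M A k s p x}
  -- `S` is the isometric inclusion of functions on `X`, with `S Sᴴ = Q`. Factoring `Q` through `X`
  -- makes the reduced determinant have size `card X`.
  let S : Matrix (Fin (M ^ k)) X ℂ := (1 : Matrix _ _ ℂ).submatrix id Subtype.val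
  have hSS : Sᴴ * S = 1 := by
    ext a b
    simp only [S, Matrix.mul_apply, Matrix.one_apply, Matrix.submatrix_apply,
      Matrix.conjTranspose_apply, id]
    by_cases hab : a = b
    · subst hab; simp
    · simp [hab, Subtype.val_inj, Ne.symm hab]
  have hSQ : S * Sᴴ = Q := by
    ext a b
    simp only [S, Matrix.mul_apply, Matrix.submatrix_apply, Matrix.conjTranspose_apply, id,
      Matrix.one_apply, hQ, nearProj, Matrix.diagonal_apply]
    by_cases ha : IsNear M A k s p a
    · rw [Finset.sum_eq_single (⟨a, ha⟩ : X)]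
      · by_cases hab : a = b
        · subst hab; simp [ha]
        · simp [hab, Ne.symm hab]
      · intro c _ hc
        rw [if_neg fun h => hc (Subtype.ext h.symm), zero_mul]
      · simp
    · rw [Finset.sum_eq_zero fun c _ => by
        rw [if_neg fun h => ha (by rw [h]; exact c.2), zero_mul]]
      simp [ha]
  have hS1 : ‖S‖ ≤ 1 := l2_opNorm_le_one_of_conjTranspose_mul_self hSS
  set J := Fᴴ * S with hJ
  have hJ1 : ‖J‖ ≤ 1 := (Matrix.l2_opNorm_mul _ _).trans (mul_le_one₀ hFs1 (norm_nonneg _) hS1)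
  have hJH : Jᴴ = Sᴴ * F := by rw [hJ, Matrix.conjTranspose_mul, Matrix.conjTranspose_conjTranspose]
  have hCQ : C = C * Q + E := by rw [hE, mul_sub, mul_one]; abel
  have hFC : F * C = Cᵀ * F := by
    have h : SemiconjBy F B Bᵀ := dft_mul_bakerMap A χ hNpos
    rw [hCdef, Matrix.transpose_pow]
    exact (h.pow_right p).eq
  have hCT : Cᵀ = Q * Cᵀ + Eᵀ := by
    conv_lhs => rw [hCQ]
    rw [Matrix.transpose_add, Matrix.transpose_mul, hQ, nearProj_transpose]
  set E1 := Fᴴ * Eᵀ * F with hE1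
  -- Conjugating `Cᵀ = Q Cᵀ + Eᵀ` by `F` moves the localization to the output side of `C`: `J Jᴴ =
  -- Fᴴ Q F`.
  have hCJ : C = J * (Jᴴ * C) + E1 := by
    have h1 : F * C = Q * (F * C) + Eᵀ * F := by
      rw [hFC]
      conv_lhs => rw [hCT]
      rw [Matrix.add_mul, Matrix.mul_assoc]
    calc C = Fᴴ * (F * C) := by rw [← Matrix.mul_assoc, hFF, Matrix.one_mul]
      _ = Fᴴ * (Q * (F * C) + Eᵀ * F) := by rw [← h1]
      _ = _ := by
        rw [hJH, hJ, hE1, ← hSQ, Matrix.mul_add]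
        simp only [Matrix.mul_assoc]
  have hE1e : hsq E1 ≤ e := by
    refine le_trans ?_ hEe
    rw [hE1, Matrix.mul_assoc, ← hsq_transpose E]
    refine (hsq_mul_le _ _).trans ((mul_le_of_le_one_left (hsq_nonneg _)
      (pow_le_one₀ (norm_nonneg _) hFs1)).trans ?_)
    exact (hsq_mul_le' _ _).trans (mul_le_of_le_one_right (hsq_nonneg _)
      (pow_le_one₀ (norm_nonneg _) hF1))
  have hcard : (Fintype.card X : ℝ) ≤ x := by
    rw [hx]; exact_mod_cast card_isNear_le A hsk.le
  -- Position localization on the right of `C` meets the frequency localization in `J`. What remains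
  -- is a block of `Fᴴ` with at most `x ^ 2` entries of squared modulus `1 / N`; this is the source
  -- of the `-1` in the exponent.
  have hHS : hsq (C * J) ≤ 2 * (x ^ 2 / (M : ℝ) ^ k) + 2 * e := by
    have h1 : C * J = (C * S) * (Sᴴ * Fᴴ * S) + E * J := by
      conv_lhs => rw [hCQ]
      rw [Matrix.add_mul, hJ, ← hSQ]
      simp only [Matrix.mul_assoc]
    have h2 : hsq (Sᴴ * Fᴴ * S) ≤ x ^ 2 / (M : ℝ) ^ k := by
      have h3 : Sᴴ * Fᴴ * S = Fᴴ.submatrix Subtype.val Subtype.val := by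
        ext a b
        simp [S, Matrix.mul_apply, Matrix.one_apply]
      rw [h3]
      refine (hsq_le_of_entry_le _ (b := 1 / Real.sqrt (M ^ k : ℕ)) fun a b => ?_).trans ?_
      · rw [Matrix.submatrix_apply, Matrix.conjTranspose_apply, norm_star, hF, norm_dft_apply]
      · rw [div_pow, one_pow, Real.sq_sqrt (by positivity), mul_one_div, ← sq]
        push_cast
        gcongr
    have h4 : ‖C * S‖ ≤ 1 :=
      (Matrix.l2_opNorm_mul _ _).trans (mul_le_one₀ hC1 (norm_nonneg _) hS1)
    rw [h1]
    refine (hsq_add_le _ _).trans ?_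
    gcongr
    · exact (hsq_mul_le _ _).trans ((mul_le_of_le_one_left (hsq_nonneg _)
        (pow_le_one₀ (norm_nonneg _) h4)).trans h2)
    · exact (hsq_mul_le' _ _).trans ((mul_le_of_le_one_right (hsq_nonneg _)
        (pow_le_one₀ (norm_nonneg _) hJ1)).trans hEe)
  have hroots : ∀ z : ℂ, (1 - z • C).det =
      ((B.charpoly.roots.map fun μ => μ ^ p).map fun μ => 1 - z * μ).prod := by
    intro z
    rw [hCdef, det_one_sub_smul_pow, Multiset.map_map]
    rfl
  set r : ℝ := ((M : ℝ) ^ ν) ^ p with hr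
  have hr0 : 0 < r := by positivity
  have hR0 : 0 ≤ R := by rw [hR]; positivity
  have hRE : ((1 + Real.exp 1) * r) ^ 2 * hsq E1 ≤ 1 / 4 := by
    rw [← hR]
    exact (mul_le_mul_of_nonneg_left hE1e (by positivity)).trans hRe
  have hcount : (eigenvalueCount M A χ k ν : ℝ) ≤
      (((B.charpoly.roots.map fun μ => μ ^ p).filter fun μ => r⁻¹ ≤ ‖μ‖).card : ℝ) := by
    exact_mod_cast eigenvalueCount_le M (by omega) A χ k p ν
  constructor
  · refine hcount.trans ?_
    have h := card_filter_eigenvalues_le_hsq C E1 J _ hroots hC1 hJ1 hCJ hr0 hRE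
    rw [← hR] at h
    refine (by convert h : _ ≤ _).trans ?_
    gcongr
  · refine hcount.trans ?_
    have h := card_filter_eigenvalues_le_card C E1 J _ hroots hC1 hJ1 hCJ hr0 hRE
    rw [← hR] at h
    refine (by convert h : _ ≤ _).trans ?_
    have : 0 ≤ Real.log (1 + 2 * R) := Real.log_nonneg (by linarith)
    gcongr

/-- The intended values are `T = N`, `U = N ^ ν` and `V = N ^ (2 (δ + η))`; the main term is then `U
^ 2 V / T`, and every term containing `e` is dominated by it. -/
lemma hilbertSchmidt_bound_arith {T U V C e R x : ℝ} (hT : 1 ≤ T) (hU : 1 ≤ U) (hV : 1 ≤ V)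
    (hC : 0 ≤ C) (he : e ≤ C / (U ^ 2 * T ^ 3)) (hR0 : 0 ≤ R) (hR : R ≤ 4 * U)
    (hx : x ^ 2 ≤ 9 * V) :
    R ^ 2 * e ≤ 16 * C / T ∧
    R ^ 2 * (2 * (2 * (x ^ 2 / T) + 2 * e) + 8 * R ^ 2 * e) ≤
      (576 + 2112 * C) * (U ^ 2 * V / T) := by
  have hR2 : R ^ 2 ≤ 16 * U ^ 2 := by nlinarith
  have hT3 : T ≤ T ^ 3 := le_self_pow₀ hT (by norm_num)
  have hU2 : 1 ≤ U ^ 2 := one_le_pow₀ hU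
  have hCe : R ^ 2 * e ≤ 16 * C / T := by
    calc R ^ 2 * e ≤ R ^ 2 * (C / (U ^ 2 * T ^ 3)) := by gcongr
      _ ≤ (16 * U ^ 2) * (C / (U ^ 2 * T ^ 3)) := by gcongr
      _ = 16 * C / T ^ 3 := by field_simp
      _ ≤ 16 * C / T := by gcongr
  refine ⟨hCe, ?_⟩
  have h1 : R ^ 2 * (x ^ 2 / T) ≤ 144 * (U ^ 2 * V / T) := by
    calc R ^ 2 * (x ^ 2 / T) ≤ (16 * U ^ 2) * (9 * V / T) := by gcongr
      _ = _ := by ring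
  have h2 : 16 * C / T ≤ 16 * C * (U ^ 2 * V / T) := by
    rw [mul_div_assoc' (16 * C)]
    have := le_mul_of_one_le_right (by positivity : 0 ≤ 16 * C)
      (one_le_mul_of_one_le_of_one_le hU2 hV)
    exact div_le_div_of_nonneg_right this (by positivity)
  have h3 : R ^ 2 * (R ^ 2 * e) ≤ 256 * C * (U ^ 2 * V / T) := by
    calc R ^ 2 * (R ^ 2 * e) ≤ R ^ 2 * (16 * C / T) := by gcongr
      _ ≤ (16 * U ^ 2) * (16 * C / T) := by gcongr
      _ = 256 * C * (U ^ 2 * 1 / T) := by ring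
      _ ≤ 256 * C * (U ^ 2 * V / T) := by gcongr
  calc _ = 4 * (R ^ 2 * (x ^ 2 / T)) + 4 * (R ^ 2 * e) + 8 * (R ^ 2 * (R ^ 2 * e)) := by ring
    _ ≤ 4 * (144 * (U ^ 2 * V / T)) + 4 * (16 * C * (U ^ 2 * V / T)) +
        8 * (256 * C * (U ^ 2 * V / T)) := by
      have := hCe.trans h2
      gcongr
    _ = _ := by ring

/-- Both fractal Weyl bounds, with an explicit small loss. -/
lemma exists_eventually_eigenvalueCount_le (M : ℕ) (A : Finset (Fin M)) (hA : 1 < A.card)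
    (hAM : A.card < M) (χ : ℝ → ℝ) (hχ : IsCutoff χ) (ν η : ℝ) (hν : 0 < ν) (hη : 0 < η)
    (hη2 : η ≤ 1 / 2) : ∃ K : ℝ, ∀ᶠ k : ℕ in atTop,
      (eigenvalueCount M A χ k ν : ℝ) ≤
        K * ((M : ℝ) ^ k) ^ (2 * ν + 2 * dimension M A - 1 + 2 * η) ∧
      (eigenvalueCount M A χ k ν : ℝ) ≤ K * ((M : ℝ) ^ k) ^ (dimension M A + 2 * η) := by
  have hM2 : 2 ≤ M := by omega
  have hM1 : (1 : ℝ) < M := by exact_mod_cast (by omega : 1 < M)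
  have hM0 : (0 : ℝ) < M := by linarith
  have hq1 : (1 : ℝ) ≤ A.card := by exact_mod_cast hA.le
  set δ := dimension M A with hδ
  have hδ0 : 0 ≤ δ := div_nonneg (Real.log_nonneg hq1) (Real.log_nonneg hM1.le)
  have hqδ : (A.card : ℝ) = (M : ℝ) ^ δ := by
    rw [Real.rpow_def_of_pos hM0, hδ, dimension, mul_div_cancel₀ _ (Real.log_pos hM1).ne',
      Real.exp_log (by linarith)]
  -- With `M ^ s ≈ T ^ η`, this order of decay gains `T ^ (-(ν + 3))` per entry. Squaring, and
  -- paying `T ^ 2` for the entries and `2 T` for the telescoping, gives `e ≤ C / (U ^ 2 T ^ 3)`.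
  obtain ⟨n, hn⟩ := exists_nat_ge ((ν + 3) / η)
  rw [div_le_iff₀ hη] at hn
  obtain ⟨K, hK, hcount⟩ := exists_eigenvalueCount_bound hM2 A hχ n
  set C : ℝ := 2 * K ^ 2 * ((M : ℝ) ^ n) ^ 2 with hC
  have hC0 : 0 ≤ C := by positivity
  set D : ℝ := 3 * ((9 : ℝ) ^ (η / ν) / (η / ν)) with hD
  refine ⟨max (576 + 2112 * C) D, ?_⟩
  have hlarge : ∀ᶠ k : ℕ in atTop, 64 * C ≤ (M : ℝ) ^ k :=
    (tendsto_pow_atTop_atTop_of_one_lt hM1).eventually_ge_atTop _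
  filter_upwards [hlarge, eventually_ge_atTop 1] with k hTC hk
  set T : ℝ := (M : ℝ) ^ k with hTdef
  have hT : 1 ≤ T := one_le_pow₀ hM1.le
  have hT0 : 0 < T := by linarith
  have hTpow : ∀ y : ℝ, T ^ y = (M : ℝ) ^ (k * y) := fun y => by
    rw [hTdef, ← Real.rpow_natCast, ← Real.rpow_mul hM0.le]
  set s := ⌊η * k⌋₊ with hs
  have hk0 : (1 : ℝ) ≤ k := by exact_mod_cast hk
  have hsle : (s : ℝ) ≤ η * k := Nat.floor_le (by positivity)
  have hslt : η * k < s + 1 := Nat.lt_floor_add_one _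
  have hsk : s < k := by
    have : (s : ℝ) < k := by nlinarith
    exact_mod_cast this
  have hMs : (M : ℝ) ^ s ≤ T ^ η := by
    rw [hTpow, ← Real.rpow_natCast]
    exact Real.rpow_le_rpow_of_exponent_le hM1.le (by linarith)
  have hMs' : T ^ η ≤ M * (M : ℝ) ^ s := by
    rw [hTpow, ← pow_succ', ← Real.rpow_natCast]
    exact Real.rpow_le_rpow_of_exponent_le hM1.le (by push_cast; linarith)
  set p := k - s with hp
  have hpk : (p : ℝ) ≤ k := by exact_mod_cast Nat.sub_le k s
  have hq : (A.card : ℝ) ^ p ≤ T ^ δ := by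
    rw [hqδ, hTpow, ← Real.rpow_natCast, ← Real.rpow_mul hM0.le]
    exact Real.rpow_le_rpow_of_exponent_le hM1.le (by nlinarith)
  set U := T ^ ν with hU
  have hU1 : 1 ≤ U := Real.one_le_rpow hT hν.le
  have hUp : ((M : ℝ) ^ ν) ^ p ≤ U := by
    rw [hU, hTpow, ← Real.rpow_natCast, ← Real.rpow_mul hM0.le]
    exact Real.rpow_le_rpow_of_exponent_le hM1.le (by nlinarith)
  have h2p : (2 : ℝ) ^ (p + 1) ≤ 2 * T := by
    rw [pow_succ']
    have : (2 : ℝ) ^ p ≤ T := by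
      calc (2 : ℝ) ^ p ≤ (M : ℝ) ^ p := by
            gcongr; exact_mod_cast hM2
        _ ≤ (M : ℝ) ^ k := pow_le_pow_right₀ hM1.le (Nat.sub_le k s)
    linarith
  have hinv : (((M : ℝ) ^ s) ^ n)⁻¹ ≤ (M : ℝ) ^ n * (U * T ^ 3)⁻¹ := by
    have h1 : U * T ^ 3 ≤ (M : ℝ) ^ n * ((M : ℝ) ^ s) ^ n := by
      calc U * T ^ 3 = T ^ (ν + 3) := by
            rw [Real.rpow_add hT0]
            norm_cast
        _ ≤ T ^ (η * n) := Real.rpow_le_rpow_of_exponent_le hT (by linarith)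
        _ = (T ^ η) ^ n := by rw [Real.rpow_mul hT0.le, Real.rpow_natCast]
        _ ≤ (M * (M : ℝ) ^ s) ^ n := by gcongr
        _ = _ := mul_pow _ _ _
    rw [← div_eq_mul_inv, inv_le_comm₀ (by positivity) (by positivity), inv_div,
      div_le_iff₀ (by positivity)]
    linarith
  set e : ℝ := 2 ^ (p + 1) * (T ^ 2 * (K * (((M : ℝ) ^ s) ^ n)⁻¹) ^ 2) with he
  have heb : e ≤ C / (U ^ 2 * T ^ 3) := by
    calc e ≤ (2 * T) * (T ^ 2 * (K * ((M : ℝ) ^ n * (U * T ^ 3)⁻¹)) ^ 2) := by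
          rw [he]; gcongr
      _ = C / (U ^ 2 * T ^ 3) := by rw [hC]; field_simp
  set R : ℝ := (1 + Real.exp 1) * ((M : ℝ) ^ ν) ^ p with hR
  have hR0 : 0 ≤ R := by positivity
  have hRU : R ≤ 4 * U := by
    have : 1 + Real.exp 1 ≤ 4 := by linarith [Real.exp_one_lt_d9]
    rw [hR]; gcongr
  set x : ℝ := 3 * (A.card : ℝ) ^ p * (M : ℝ) ^ s with hx
  have hx0 : 0 ≤ x := by positivity
  have hxb : x ≤ 3 * T ^ (δ + η) := by
    rw [hx, Real.rpow_add hT0, ← mul_assoc]; gcongr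
  set V : ℝ := (T ^ (δ + η)) ^ 2 with hV
  have hV1 : 1 ≤ V := one_le_pow₀ (Real.one_le_rpow hT (by linarith))
  have hx2 : x ^ 2 ≤ 9 * V := by
    calc x ^ 2 ≤ (3 * T ^ (δ + η)) ^ 2 := by gcongr
      _ = _ := by rw [hV]; ring
  obtain ⟨hRe, hHS⟩ := hilbertSchmidt_bound_arith hT hU1 hV1 hC0 heb hR0 hRU hx2
  have hRe' : R ^ 2 * e ≤ 1 / 4 := by
    refine hRe.trans ?_
    rw [div_le_iff₀ hT0]; linarith
  obtain ⟨hc1, hc2⟩ := hcount k s ν e R x hsk rfl rfl rfl hRe'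
  constructor
  · have hpow : U ^ 2 * V / T = T ^ (2 * ν + 2 * δ - 1 + 2 * η) := by
      have hexp : 2 * ν + 2 * δ - 1 + 2 * η = ν * (2 : ℕ) + (δ + η) * (2 : ℕ) - 1 := by
        push_cast; ring
      rw [hexp, Real.rpow_sub hT0, Real.rpow_add hT0, Real.rpow_mul hT0.le, Real.rpow_mul hT0.le,
        Real.rpow_natCast, Real.rpow_natCast, Real.rpow_one]
    rw [← hpow]
    refine (hc1.trans hHS).trans ?_
    gcongr
    exact le_max_left _ _
  -- The logarithm costs a second `T ^ η`: `1 + 2 R ≤ 9 U`, and the exponent `η / ν` is chosen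
  -- because `U ^ (η / ν) = T ^ η`.
  · have hlog : Real.log (1 + 2 * R) ≤ (9 : ℝ) ^ (η / ν) / (η / ν) * T ^ η := by
      calc Real.log (1 + 2 * R) ≤ Real.log (9 * U) := Real.log_le_log (by linarith) (by linarith)
        _ ≤ (9 * U) ^ (η / ν) / (η / ν) := Real.log_le_rpow_div (by positivity) (by positivity)
        _ = _ := by
          rw [Real.mul_rpow (by norm_num) (by positivity), hU, ← Real.rpow_mul hT0.le,
            mul_div_cancel₀ _ hν.ne']
          ring
    have hlog0 : 0 ≤ Real.log (1 + 2 * R) := Real.log_nonneg (by linarith)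
    calc _ ≤ x * Real.log (1 + 2 * R) := hc2
      _ ≤ (3 * T ^ (δ + η)) * ((9 : ℝ) ^ (η / ν) / (η / ν) * T ^ η) := by gcongr
      _ = D * T ^ (δ + 2 * η) := by
        have hexp : δ + 2 * η = (δ + η) + η := by ring
        rw [hexp, Real.rpow_add hT0 (δ + η) η, hD]; ring
      _ ≤ _ := by
        gcongr
        exact le_max_right _ _

end OpenBaker

theorem theorem3 (M : ℕ) (A : Finset (Fin M)) (hA : 1 < A.card) (hAM : A.card < M)
    (χ : ℝ → ℝ) (hχ : OpenBaker.IsCutoff χ) (ν ε : ℝ) (hν : 0 < ν) (hε : 0 < ε) :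
    (fun k : ℕ => (OpenBaker.eigenvalueCount M A χ k ν : ℝ)) =O[atTop]
      (fun k : ℕ => ((M : ℝ) ^ k) ^
        (min (2 * ν + 2 * OpenBaker.dimension M A - 1) (OpenBaker.dimension M A) + ε)) := by
  -- The total loss is `2 η`, hence `ε / 2`; the cap `1 / 2` ensures `s = ⌊η k⌋ < k`.
  obtain ⟨K, hK⟩ := OpenBaker.exists_eventually_eigenvalueCount_le M A hA hAM χ hχ ν
    (min (ε / 2) (1 / 2)) hν (by positivity) (min_le_right _ _)
  have hM1 : (1 : ℝ) ≤ M := by exact_mod_cast (by omega : 1 ≤ M)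
  refine IsBigO.of_bound |K| ?_
  filter_upwards [hK] with k hk
  have hT : (1 : ℝ) ≤ (M : ℝ) ^ k := one_le_pow₀ hM1
  rw [Real.norm_of_nonneg (by positivity), Real.norm_of_nonneg (by positivity)]
  have hη : 2 * min (ε / 2) (1 / 2) ≤ ε := by linarith [min_le_left (ε / 2) (1 / 2 : ℝ)]
  have key : ∀ y : ℝ, K * ((M : ℝ) ^ k) ^ (y + 2 * min (ε / 2) (1 / 2)) ≤
      |K| * ((M : ℝ) ^ k) ^ (y + ε) := fun y => by
    have h1 := le_abs_self K
    have h2 : ((M : ℝ) ^ k) ^ (y + 2 * min (ε / 2) (1 / 2)) ≤ ((M : ℝ) ^ k) ^ (y + ε) :=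
      Real.rpow_le_rpow_of_exponent_le hT (by linarith)
    gcongr
  rcases le_total (2 * ν + 2 * OpenBaker.dimension M A - 1) (OpenBaker.dimension M A) with h | h
  · rw [min_eq_left h]; exact hk.1.trans (key _)
  · rw [min_eq_right h]; exact hk.2.trans (key _)
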